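/- Let $M_0$ be a nonzero additive subgroup of $\mathbb{C}$ with $\mathbb{Z}\cap M_0=\{0\}$, let $M=\mathbb{Z}\oplus M_0\subset\mathbb{C}$, and let $L=\mathrm{Vir}[M]/\mathbb{C}c$ be the centreless generalized Virasoro algebra: the complex Lie algebra with basis $\{d_m : m\in M\}$ and bracket $[d_m,d_n]=(n-m)\,d_{m+n}$. For $i\in\mathbb{Z}$ put $L_i=\bigoplus_{a\in M_0}\mathbb{C}d_{i+a}$, and let $L_+=\bigoplus_{i>0}L_i$. For $\alpha,\beta\in\mathbb{C}$ let $V(\alpha,\beta)=\bigoplus_{b\in M_0}\mathbb{C}v_b$ be the $(L_++L_0)$-module on which $d_av_b=(b+\alpha+a\beta)\,v_{a+b}$ for $a,b\in M_0$ and $L_+V(\alpha,\beta)=0$. Let $\widetilde V=U(L)\otimes_{U(L_++L_0)}V(\alpha,\beta)$ be the induced $L$-module, let $J$ be the largest submodule of $\widetilde V$ that intersects $V(\alpha,\beta)$ trivially, and put $\bar V=\bar V(\alpha,\beta)=\widetilde V/J$. For $\mu\in\mathbb{C}$ let $\bar V_\mu=\{w\in\bar V : d_0w=\mu w\}$. Then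 for all $\alpha,\beta\in\mathbb{C}$, every integer $i\ge 0$ and all $a_1,a_2\in M_0$ with $(-i+\alpha+a_1)(-i+\alpha+a_2)\neq 0$, $$\dim\bar V_{-i+\alpha+a_1}=\dim\bar V_{-i+\alpha+a_2}.$$ -/

import Mathlib

noncomputable section

namespace GenVir

/-- The index group `M = ℤ ⊕ M₀`. When `ℤ ∩ M₀ = 0` the map `val` below is injective and
identifies it with the subgroup `ℤ + M₀` of `ℂ`. -/
abbrev Idx (M₀ : AddSubgroup ℂ) : Type := ℤ × M₀

/-- The complex number `i + a` attached to the index `(i, a)`. -/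
def val {M₀ : AddSubgroup ℂ} (m : Idx M₀) : ℂ := (m.1 : ℂ) + (m.2 : ℂ)

theorem val_add {M₀ : AddSubgroup ℂ} (m n : Idx M₀) : val (m + n) = val m + val n := by
  simp only [val, Prod.fst_add, Prod.snd_add, Int.cast_add, AddSubgroup.coe_add]
  ring

/-- The centreless generalized Virasoro algebra `L = Vir[M] / ℂ c`, as a vector space: it has a
basis of vectors `d m`, for `m` in `M = ℤ ⊕ M₀`. -/
def L (M₀ : AddSubgroup ℂ) : Type := Idx M₀ →₀ ℂ

instance (M₀ : AddSubgroup ℂ) : AddCommGroup (L M₀) :=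
  inferInstanceAs (AddCommGroup (Idx M₀ →₀ ℂ))

instance (M₀ : AddSubgroup ℂ) : Module ℂ (L M₀) :=
  inferInstanceAs (Module ℂ (Idx M₀ →₀ ℂ))

/-- The basis vector `d_m` of `L`. -/
def d {M₀ : AddSubgroup ℂ} (m : Idx M₀) : L M₀ := Finsupp.single m (1 : ℂ)

/-- The linear map on `L` with prescribed values on the basis vectors `d m`. -/
def ext {M₀ : AddSubgroup ℂ} {W : Type*} [AddCommGroup W] [Module ℂ W] (f : Idx M₀ → W) :
    L M₀ →ₗ[ℂ] W :=
  Finsupp.linearCombination ℂ f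

theorem ext_d {M₀ : AddSubgroup ℂ} {W : Type*} [AddCommGroup W] [Module ℂ W] (f : Idx M₀ → W)
    (m : Idx M₀) : ext f (d m) = f m := by
  simp only [ext, d]
  exact (Finsupp.linearCombination_single ℂ (1 : ℂ) m).trans (one_smul ℂ _)

theorem hom_ext {M₀ : AddSubgroup ℂ} {W : Type*} [AddCommGroup W] [Module ℂ W]
    {f g : L M₀ →ₗ[ℂ] W} (h : ∀ m, f (d m) = g (d m)) : f = g :=
  Finsupp.lhom_ext' fun m => LinearMap.ext_ring (h m)

/-- The bracket of `L` as a bilinear map: `[d_m, d_n] = (n - m) d_{m+n}`. -/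
def brk (M₀ : AddSubgroup ℂ) : L M₀ →ₗ[ℂ] L M₀ →ₗ[ℂ] L M₀ :=
  ext fun m => ext fun n => (val n - val m) • d (m + n)

theorem brk_d {M₀ : AddSubgroup ℂ} (m n : Idx M₀) :
    brk M₀ (d m) (d n) = (val n - val m) • d (m + n) := by
  rw [brk, ext_d, ext_d]

theorem brk_skew {M₀ : AddSubgroup ℂ} (x y : L M₀) : brk M₀ x y = -brk M₀ y x := by
  have h : brk M₀ = -(brk M₀).flip := by
    refine hom_ext fun m => hom_ext fun n => ?_
    rw [LinearMap.neg_apply, LinearMap.neg_apply, LinearMap.flip_apply, brk_d, brk_d,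
      add_comm n m, ← neg_smul, neg_sub]
  exact LinearMap.congr_fun (LinearMap.congr_fun h x) y

theorem brk_self {M₀ : AddSubgroup ℂ} (x : L M₀) : brk M₀ x x = 0 := by
  have h := brk_skew x x
  have h2 : (2 : ℂ) • brk M₀ x x = 0 := by
    rw [two_smul]
    nth_rewrite 1 [h]
    exact neg_add_cancel _
  exact (smul_eq_zero.mp h2).resolve_left two_ne_zero

theorem induction_d {M₀ : AddSubgroup ℂ} {p : L M₀ → Prop} (x : L M₀) (h0 : p 0)
    (hadd : ∀ y z, p y → p z → p (y + z)) (hsmul : ∀ (c : ℂ) y, p y → p (c • y))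
    (hd : ∀ m, p (d m)) : p x := by
  refine Finsupp.induction_linear x h0 hadd fun m c => ?_
  have h : (Finsupp.single m c : Idx M₀ →₀ ℂ) = c • Finsupp.single m (1 : ℂ) := by simp
  rw [h]
  exact hsmul c _ (hd m)

theorem brk_leibniz {M₀ : AddSubgroup ℂ} (x y z : L M₀) :
    brk M₀ x (brk M₀ y z) = brk M₀ (brk M₀ x y) z + brk M₀ y (brk M₀ x z) := by
  induction x using induction_d with
  | h0 => simp
  | hadd x x' h h' => simp only [map_add, LinearMap.add_apply, h, h']; abel
  | hsmul c x h => simp only [map_smul, LinearMap.smul_apply, h, smul_add]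
  | hd m =>
  induction y using induction_d with
  | h0 => simp
  | hadd x x' h h' => simp only [map_add, LinearMap.add_apply, h, h']; abel
  | hsmul c x h => simp only [map_smul, LinearMap.smul_apply, h, smul_add]
  | hd n =>
  induction z using induction_d with
  | h0 => simp
  | hadd x x' h h' => simp only [map_add, h, h']; abel
  | hsmul c x h => simp only [map_smul, h, smul_add]
  | hd k =>
  simp only [brk_d, map_smul, LinearMap.smul_apply, smul_smul, val_add]
  rw [add_left_comm n m k, ← add_assoc m n k, ← add_smul]
  congr 1
  ring

instance (M₀ : AddSubgroup ℂ) : LieRing (L M₀) where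
  bracket x y := brk M₀ x y
  add_lie x y z := by simp
  lie_add x y z := by simp
  lie_self x := brk_self x
  leibniz_lie x y z := brk_leibniz x y z

instance (M₀ : AddSubgroup ℂ) : LieAlgebra ℂ (L M₀) where
  lie_smul c x y := map_smul (brk M₀ x) c y

theorem lie_d {M₀ : AddSubgroup ℂ} (m n : Idx M₀) :
    ⁅(d m : L M₀), (d n : L M₀)⁆ = (val n - val m) • d (m + n) := brk_d m n

/-- The subalgebra `L₊ + L₀`, spanned by the `d_{i+a}` with `i ≥ 0` and `a ∈ M₀`. -/
def nonneg (M₀ : AddSubgroup ℂ) : LieSubalgebra ℂ (L M₀) where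
  toSubmodule := Submodule.span ℂ (d '' {m : Idx M₀ | 0 ≤ m.1})
  lie_mem' {x y} hx hy := by
    change x ∈ Submodule.span ℂ (d '' {m : Idx M₀ | 0 ≤ m.1}) at hx
    change y ∈ Submodule.span ℂ (d '' {m : Idx M₀ | 0 ≤ m.1}) at hy
    change ⁅x, y⁆ ∈ Submodule.span ℂ (d '' {m : Idx M₀ | 0 ≤ m.1})
    induction hx, hy using Submodule.span_induction₂ with
    | mem_mem x y hx hy =>
      obtain ⟨m, hm, rfl⟩ := hx
      obtain ⟨n, hn, rfl⟩ := hy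
      rw [lie_d]
      exact Submodule.smul_mem _ _ (Submodule.subset_span ⟨m + n, Int.add_nonneg hm hn, rfl⟩)
    | zero_left y hy => rw [zero_lie]; exact Submodule.zero_mem _
    | zero_right x hx => rw [lie_zero]; exact Submodule.zero_mem _
    | add_left x y z _ _ _ h h' => rw [add_lie]; exact Submodule.add_mem _ h h'
    | add_right x y z _ _ _ h h' => rw [lie_add]; exact Submodule.add_mem _ h h'
    | smul_left r x y _ _ h => rw [smul_lie]; exact Submodule.smul_mem _ _ h
    | smul_right r x y _ _ h => rw [lie_smul]; exact Submodule.smul_mem _ _ h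

attribute [local instance] LieRing.ofAssociativeRing

/-- The underlying space of `V(α, β)`: it has a basis of vectors `v b`, for `b ∈ M₀`. -/
def V (M₀ : AddSubgroup ℂ) : Type := M₀ →₀ ℂ

instance (M₀ : AddSubgroup ℂ) : AddCommGroup (V M₀) :=
  inferInstanceAs (AddCommGroup (M₀ →₀ ℂ))

instance (M₀ : AddSubgroup ℂ) : Module ℂ (V M₀) :=
  inferInstanceAs (Module ℂ (M₀ →₀ ℂ))

/-- The basis vector `v_b` of `V(α, β)`. -/
def v {M₀ : AddSubgroup ℂ} (b : M₀) : V M₀ := Finsupp.single b (1 : ℂ)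

/-- The linear map on `V(α, β)` with prescribed values on the basis vectors `v b`. -/
def extV {M₀ : AddSubgroup ℂ} {W : Type*} [AddCommGroup W] [Module ℂ W] (f : M₀ → W) :
    V M₀ →ₗ[ℂ] W :=
  Finsupp.linearCombination ℂ f

theorem extV_v {M₀ : AddSubgroup ℂ} {W : Type*} [AddCommGroup W] [Module ℂ W] (f : M₀ → W)
    (b : M₀) : extV f (v b) = f b := by
  simp only [extV, v]
  exact (Finsupp.linearCombination_single ℂ (1 : ℂ) b).trans (one_smul ℂ _)

theorem homV_ext {M₀ : AddSubgroup ℂ} {W : Type*} [AddCommGroup W] [Module ℂ W]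
    {f g : V M₀ →ₗ[ℂ] W} (h : ∀ b, f (v b) = g (v b)) : f = g :=
  Finsupp.lhom_ext' fun b => LinearMap.ext_ring (h b)

/-- The operators on `V(α, β)` given by `d_a v_b = (b + α + a β) v_{a+b}` for `a ∈ M₀`, and by
`d_{i+a} v_b = 0` for `i ≠ 0`. Only their restriction to `L₊ + L₀` is used. -/
def act {M₀ : AddSubgroup ℂ} (α β : ℂ) : L M₀ →ₗ[ℂ] Module.End ℂ (V M₀) :=
  ext fun m => if m.1 = 0 then
    extV fun b : M₀ => ((b : ℂ) + α + (m.2 : ℂ) * β) • v (m.2 + b)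
    else 0

theorem act_d {M₀ : AddSubgroup ℂ} (α β : ℂ) (a b : M₀) :
    act α β (d (0, a)) (v b) = ((b : ℂ) + α + (a : ℂ) * β) • v (a + b) := by
  rw [act, ext_d, if_pos rfl, extV_v]

theorem act_d_of_ne {M₀ : AddSubgroup ℂ} (α β : ℂ) (m : Idx M₀) (hm : m.1 ≠ 0) :
    act α β (d m) = 0 := by
  rw [act, ext_d, if_neg hm]

theorem act_lie_d {M₀ : AddSubgroup ℂ} (α β : ℂ) (m n : Idx M₀) (hm : 0 ≤ m.1) (hn : 0 ≤ n.1) :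
    act α β ⁅(d m : L M₀), (d n : L M₀)⁆
      = act α β (d m) * act α β (d n) - act α β (d n) * act α β (d m) := by
  obtain ⟨i, a⟩ := m
  obtain ⟨j, b⟩ := n
  simp only at hm hn
  rw [lie_d, map_smul]
  by_cases hi : i = 0
  · by_cases hj : j = 0
    · subst hi hj
      refine homV_ext fun k => ?_
      simp only [LinearMap.smul_apply, LinearMap.sub_apply, Module.End.mul_apply,
        Prod.mk_add_mk, add_zero, act_d, map_smul, smul_smul]
      rw [add_left_comm b a k, ← add_assoc a b k, ← sub_smul]
      congr 1
      simp only [val, AddSubgroup.coe_add, Int.cast_zero]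
      ring
    · rw [act_d_of_ne α β (j, b) hj, act_d_of_ne α β _ (by simp only [Prod.fst_add]; omega)]
      simp
  · rw [act_d_of_ne α β (i, a) hi, act_d_of_ne α β _ (by simp only [Prod.fst_add]; omega)]
    simp

theorem act_lie {M₀ : AddSubgroup ℂ} (α β : ℂ) {x y : L M₀} (hx : x ∈ nonneg M₀)
    (hy : y ∈ nonneg M₀) :
    act α β ⁅x, y⁆ = act α β x * act α β y - act α β y * act α β x := by
  change x ∈ Submodule.span ℂ (d '' {m : Idx M₀ | 0 ≤ m.1}) at hx
  change y ∈ Submodule.span ℂ (d '' {m : Idx M₀ | 0 ≤ m.1}) at hy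
  induction hx, hy using Submodule.span_induction₂ with
  | mem_mem x y hx hy =>
    obtain ⟨m, hm, rfl⟩ := hx
    obtain ⟨n, hn, rfl⟩ := hy
    exact act_lie_d α β m n hm hn
  | zero_left y hy => simp
  | zero_right x hx => simp
  | add_left x y z _ _ _ h h' => simp only [add_lie, map_add, h, h', add_mul, mul_add]; abel
  | add_right x y z _ _ _ h h' => simp only [lie_add, map_add, h, h', add_mul, mul_add]; abel
  | smul_left r x y _ _ h =>
    simp only [smul_lie, map_smul, h, smul_mul_assoc, mul_smul_comm, smul_sub]
  | smul_right r x y _ _ h =>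
    simp only [lie_smul, map_smul, h, smul_mul_assoc, mul_smul_comm, smul_sub]

/-- The module `V(α, β)` over `L₊ + L₀`: `L₀` acts by `d_a v_b = (b + α + a β) v_{a+b}` and `L₊`
acts by zero. -/
def rho (M₀ : AddSubgroup ℂ) (α β : ℂ) : nonneg M₀ →ₗ⁅ℂ⁆ Module.End ℂ (V M₀) where
  toLinearMap := (act α β).comp (nonneg M₀).toSubmodule.subtype
  map_lie' {x y} := act_lie α β x.2 y.2

/-- The universal enveloping algebra of `L`. A left `U`-module is the same as an `L`-module. -/
abbrev U (M₀ : AddSubgroup ℂ) : Type := UniversalEnvelopingAlgebra ℂ (L M₀)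

open scoped TensorProduct

/-- The left `U(L)`-submodule of `U(L) ⊗_ℂ V(α, β)` that has to be divided out to get the tensor
product over `U(L₊ + L₀)`. Since `L₊ + L₀` generates its enveloping algebra and the submodule is
stable under left multiplication, the relations `x ⊗ v = 1 ⊗ x v` with `x ∈ L₊ + L₀` give all
relations `u w ⊗ v = u ⊗ w v` with `w ∈ U(L₊ + L₀)`. -/
def indRel (M₀ : AddSubgroup ℂ) (α β : ℂ) : Submodule (U M₀) (U M₀ ⊗[ℂ] V M₀) :=
  Submodule.span (U M₀)
    {t | ∃ (x : nonneg M₀) (v : V M₀),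
      t = UniversalEnvelopingAlgebra.ι ℂ (x : L M₀) ⊗ₜ[ℂ] v - 1 ⊗ₜ[ℂ] rho M₀ α β x v}

/-- The induced module `Ṽ(α, β) = U(L) ⊗_{U(L₊ + L₀)} V(α, β)`. -/
abbrev Vtilde (M₀ : AddSubgroup ℂ) (α β : ℂ) : Type :=
  (U M₀ ⊗[ℂ] V M₀) ⧸ indRel M₀ α β

/-- The canonical map `v ↦ 1 ⊗ v` from `V(α, β)` to `Ṽ(α, β)`. -/
def emb (M₀ : AddSubgroup ℂ) (α β : ℂ) : V M₀ →ₗ[ℂ] Vtilde M₀ α β :=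
  ((indRel M₀ α β).mkQ.restrictScalars ℂ).comp (TensorProduct.mk ℂ (U M₀) (V M₀) 1)

/-- The largest submodule `J` of `Ṽ(α, β)` that intersects `V(α, β)` trivially: the sum of all
submodules with that property. -/
def J (M₀ : AddSubgroup ℂ) (α β : ℂ) : Submodule (U M₀) (Vtilde M₀ α β) :=
  sSup {N | N.restrictScalars ℂ ⊓ LinearMap.range (emb M₀ α β) = ⊥}

/-- The quotient module `V̄(α, β) = Ṽ(α, β) / J`. -/
abbrev Vbar (M₀ : AddSubgroup ℂ) (α β : ℂ) : Type := Vtilde M₀ α β ⧸ J M₀ α β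

/-- The weight space `V̄_μ = {w ∈ V̄(α, β) | d₀ w = μ w}`. -/
def wt (M₀ : AddSubgroup ℂ) (α β μ : ℂ) : Submodule ℂ (Vbar M₀ α β) where
  carrier := {w | UniversalEnvelopingAlgebra.ι ℂ (d (0 : Idx M₀)) • w = μ • w}
  zero_mem' := by simp
  add_mem' {x y} hx hy := by
    simp only [Set.mem_ofPred_eq] at hx hy ⊢
    rw [smul_add, smul_add, hx, hy]
  smul_mem' c x hx := by
    simp only [Set.mem_ofPred_eq] at hx ⊢
    rw [smul_comm, hx, smul_comm]

end GenVir

end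

noncomputable section

namespace GenVir

attribute [local instance] LieRing.ofAssociativeRing

open scoped TensorProduct

/-! ### Words in operators satisfying the commutation relations of `L` -/

section Words

variable {M₀ : AddSubgroup ℂ} {E : Type*} [AddCommGroup E] [Module ℂ E]

/-! A weight vector `w` of level `-i` in `V̄` is encoded by how the words `d_{1+c₁} ⋯ d_{1+cᵢ}` act
on it: each sends `w` to a multiple of a top vector, and the multiple is a polynomial in `c₁, …, cᵢ`
of degree at most `2i` (`exists_describes`). As `M₀` is infinite, the polynomial is unique, hence
linear in `w`. It determines `w` (`IsTop.eq_zero_of_mem_sing`): since `M₀ ≠ 0`, `L₁` generates `L₊`,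
so a vector killed by all these words generates a submodule invisible from the top level, and `V̄`
has none but zero. The weight space of `-i + α + s` thus becomes a space `E s` of polynomials.

Commuting `d_x`, `x ∈ M₀`, through the words turns its action into `polyOp`. On a polynomial of
degree `N` the terms of degree `N + 1` cancel, and Euler's identity shows that the part of degree
`N` is multiplied by `(s + α - i) + x (β + i - N)` (`polyOp_sub_mem_low`). When this scalar is
nonzero, every leading form of degree `N` in `E s` also occurs in `E (x + s)`. To get from `s` to
`t`, pass through some `u`: the two scalars are affine in `u`, and neither vanishes identically
because the weights at `s` and `t` are nonzero, so each excludes at most one `u`. The spaces of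
leading forms agree in every degree, hence so do the ranks (`rank_eq_of_polyOp`).

All this needs nonzero top vectors in `V̄` and a usable description of `J`. `exists_proj` makes `L`
act on formal words modulo relations among negative letters, and obtains a projection `π` from `Ṽ`
to `V(α, β)` that splits `emb` and kills the images of the negative operators. Since `d₀` separates
the levels, `J` consists of the `x` with `π (u x) = 0` for all `u` (`mem_J_iff`). -/

/-- The operators `ρ m` satisfy the commutation relations of the vectors `d m`. -/
def IsRep (ρ : Idx M₀ → Module.End ℂ E) : Prop :=
  ∀ m n w, ρ m (ρ n w) = ρ n (ρ m w) + (val n - val m) • ρ (m + n) w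

/-- The composition of the operators attached to the letters of a word. -/
def word (ρ : Idx M₀ → Module.End ℂ E) (l : List (Idx M₀)) : Module.End ℂ E := (l.map ρ).prod

@[simp] theorem word_nil (ρ : Idx M₀ → Module.End ℂ E) (w : E) : word ρ [] w = w := rfl

@[simp] theorem word_cons (ρ : Idx M₀ → Module.End ℂ E) (m : Idx M₀) (l : List (Idx M₀)) (w : E) :
    word ρ (m :: l) w = ρ m (word ρ l w) := by
  simp [word]

theorem word_append (ρ : Idx M₀ → Module.End ℂ E) (l l' : List (Idx M₀)) (w : E) :
    word ρ (l ++ l') w = word ρ l (word ρ l' w) := by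
  simp [word]

theorem sum_set_add {A : Type*} [AddCommMonoid A] (y : A) (l : List A) (q : ℕ) (hq : q < l.length) :
    (l.set q (y + l.getD q 0)).sum = y + l.sum := by
  induction l generalizing q with
  | nil => simp at hq
  | cons a l ih =>
    cases q with
    | zero => simp [add_assoc]
    | succ q =>
      have := ih q (by simpa using hq)
      rw [List.set_cons_succ, List.getD_cons_succ, List.sum_cons, this, List.sum_cons]
      exact add_left_comm _ _ _

/-- Moving one operator to the right through a word. -/
theorem IsRep.comm_word {ρ : Idx M₀ → Module.End ℂ E} (h : IsRep ρ) (y : Idx M₀)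
    (l : List (Idx M₀)) (w : E) :
    ρ y (word ρ l w) = ∑ q ∈ Finset.range l.length,
      (val (l.getD q 0) - val y) • word ρ (l.set q (y + l.getD q 0)) w + word ρ l (ρ y w) := by
  induction l with
  | nil => simp
  | cons a l ih =>
    rw [word_cons, h, ih, List.length_cons, Finset.sum_range_succ']
    simp only [map_add, map_sum, map_smul, List.getD_cons_succ, List.set_cons_succ, word_cons,
      List.getD_cons_zero, List.set_cons_zero]
    abel

/-- The scalar by which a word of level `0` acts on the top vectors, as a polynomial expression in
its letters. -/
def coef {R : Type*} [CommRing R] (α β : R) : List (ℤ × R) → R → R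
  | [], _ => 1
  | y :: l, b => if y.1 < 0 then 0 else
      ∑ q ∈ Finset.range l.length,
        (((l.getD q 0).1 : R) + (l.getD q 0).2 - (y.1 + y.2)) *
          coef α β (l.set q (y + l.getD q 0)) b
      + if y.1 = 0 then (b + α + y.2 * β) * coef α β l (b + y.2) else 0
termination_by l => l.length

theorem coef_nil {R : Type*} [CommRing R] (α β b : R) : coef α β [] b = 1 := by rw [coef]

theorem coef_cons {R : Type*} [CommRing R] (α β b : R) (y : ℤ × R) (l : List (ℤ × R)) :
    coef α β (y :: l) b = if y.1 < 0 then 0 else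
      ∑ q ∈ Finset.range l.length,
        (((l.getD q 0).1 : R) + (l.getD q 0).2 - (y.1 + y.2)) *
          coef α β (l.set q (y + l.getD q 0)) b
      + if y.1 = 0 then (b + α + y.2 * β) * coef α β l (b + y.2) else 0 := by
  rw [coef]

/-- Only ring operations enter `coef`. Hence the letters can be replaced by variables and the scalar
recovered by evaluation. -/
theorem map_coef {R S : Type*} [CommRing R] [CommRing S] (φ : R →+* S) (α β : R) (n : ℕ) :
    ∀ (l : List (ℤ × R)) (b : R), l.length = n →
      φ (coef α β l b) = coef (φ α) (φ β) (l.map fun y => (y.1, φ y.2)) (φ b) := by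
  induction n with
  | zero =>
    intro l b hl
    rw [List.length_eq_zero_iff.mp hl, coef_nil, List.map_nil, coef_nil, map_one]
  | succ n ih =>
    intro l b hl
    obtain ⟨y, l, rfl⟩ := List.exists_cons_of_length_eq_add_one hl
    have hl' : l.length = n := by simpa using hl
    have hD : ∀ q, (l.map fun y => (y.1, φ y.2)).getD q 0
        = ((l.getD q 0).1, φ (l.getD q 0).2) := by
      intro q
      simp only [List.getD_eq_getElem?_getD, List.getElem?_map]
      cases l[q]? <;> simp [Prod.ext_iff]
    rw [coef_cons, List.map_cons, coef_cons, apply_ite φ, map_zero, map_add, map_sum, apply_ite φ,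
      map_zero, map_mul, ih _ _ hl', List.length_map]
    simp only [hD, map_mul, map_sub, map_add, map_intCast]
    congr 2
    refine Finset.sum_congr rfl fun q _ => ?_
    rw [ih _ _ (by simpa using hl'), List.map_set]
    simp

-- Each unfolding of `coef` removes one letter and multiplies by one factor of degree at most one;
-- merged letters keep degree at most one.
open MvPolynomial in
theorem totalDegree_coef_le {σ : Type*} (α β : ℂ) (n : ℕ) :
    ∀ (l : List (ℤ × MvPolynomial σ ℂ)) (b : MvPolynomial σ ℂ), l.length = n →
      (∀ y ∈ l, y.2.totalDegree ≤ 1) → b.totalDegree ≤ 1 →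
      (coef (C α) (C β) l b).totalDegree ≤ n := by
  have hadd : ∀ {p q : MvPolynomial σ ℂ}, p.totalDegree ≤ 1 → q.totalDegree ≤ 1 →
      (p + q).totalDegree ≤ 1 := fun hp hq => (totalDegree_add _ _).trans (max_le hp hq)
  have hint : ∀ z : ℤ, (z : MvPolynomial σ ℂ).totalDegree ≤ 1 := fun z => by
    have : (z : MvPolynomial σ ℂ) = C (z : ℂ) := by simp
    rw [this, totalDegree_C]; exact Nat.zero_le _
  induction n with
  | zero =>
    intro l b hl _ _
    rw [List.length_eq_zero_iff.mp hl, coef_nil, totalDegree_one]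
  | succ n ih =>
    intro l b hl hd hb
    obtain ⟨y, l, rfl⟩ := List.exists_cons_of_length_eq_add_one hl
    have hl' : l.length = n := by simpa using hl
    have hy : y.2.totalDegree ≤ 1 := hd y (by simp)
    have hd' : ∀ z ∈ l, z.2.totalDegree ≤ 1 := fun z hz => hd z (by simp [hz])
    have hD : ∀ q, (l.getD q 0).2.totalDegree ≤ 1 := by
      intro q
      rw [List.getD_eq_getElem?_getD]
      cases hq : l[q]? with
      | none => simp
      | some z => exact hd' z (List.mem_of_getElem? hq)
    rw [coef_cons]
    split_ifs with h1 h2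
    · simp
    all_goals
      refine (totalDegree_add _ _).trans (max_le ?_ ?_)
    any_goals
      refine totalDegree_finsetSum_le fun q _ => ?_
      refine (totalDegree_mul _ _).trans ?_
      rw [add_comm n 1]
      refine add_le_add ?_ (ih _ _ (by simpa using hl') ?_ hb)
      · exact (totalDegree_sub _ _).trans
          (max_le (hadd (hint _) (hD _)) (hadd (hint _) hy))
      · intro z hz
        rcases List.mem_or_eq_of_mem_set hz with hz | rfl
        · exact hd' z hz
        · exact hadd hy (hD q)
    · refine (totalDegree_mul _ _).trans ?_
      rw [add_comm n 1]
      refine add_le_add (hadd (hadd hb (by simp)) ?_) (ih _ _ hl' hd' (hadd hb hy))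
      refine (totalDegree_mul _ _).trans ?_
      simpa using hy
    · simp

/-- Words of positive level kill the top vectors, and words of level `0` act by `coef`. -/
theorem IsRep.word_top {ρ : Idx M₀ → Module.End ℂ E} (h : IsRep ρ) {α β : ℂ} {e : M₀ → E}
    (hpos : ∀ m b, 0 < m.1 → ρ m (e b) = 0)
    (hzero : ∀ a b : M₀, ρ (0, a) (e b) = ((b : ℂ) + α + (a : ℂ) * β) • e (a + b)) (n : ℕ) :
    ∀ (l : List (Idx M₀)) (b : M₀), l.length = n →
      (0 < l.sum.1 → word ρ l (e b) = 0) ∧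
      (l.sum.1 = 0 → word ρ l (e b)
        = coef α β (l.map fun m => (m.1, (m.2 : ℂ))) b • e (l.sum.2 + b)) := by
  induction n with
  | zero =>
    intro l b hl
    rw [List.length_eq_zero_iff.mp hl]
    simp [coef_nil]
  | succ n ih =>
    intro l b hl
    obtain ⟨y, l, rfl⟩ := List.exists_cons_of_length_eq_add_one hl
    have hl' : l.length = n := by simpa using hl
    have hD : ∀ q, (l.map fun m => (m.1, (m.2 : ℂ))).getD q 0
        = ((l.getD q 0).1, ((l.getD q 0).2 : ℂ)) := by
      intro q
      simp only [List.getD_eq_getElem?_getD, List.getElem?_map]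
      cases l[q]? <;> simp [Prod.ext_iff]
    rw [List.sum_cons, Prod.fst_add, Prod.snd_add, List.map_cons, coef_cons]
    by_cases hy : y.1 < 0
    · have : word ρ (y :: l) (e b) = 0 ∨ y.1 + l.sum.1 < 0 := by
        rcases lt_or_ge 0 l.sum.1 with hs | hs
        · left
          rw [word_cons, (ih l b hl').1 hs, map_zero]
        · right; omega
      refine ⟨fun h0 => this.resolve_right (by omega), fun h0 => ?_⟩
      rw [if_pos hy, zero_smul]
      exact this.resolve_right (by omega)
    · rw [if_neg hy, word_cons, h.comm_word]
      constructor
      · intro h0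
        rw [Finset.sum_eq_zero, zero_add]
        · by_cases hy0 : 0 < y.1
          · rw [hpos _ _ hy0, map_zero]
          · obtain ⟨y1, y2⟩ := y
            obtain rfl : y1 = 0 := by simp only at hy hy0; omega
            rw [hzero, map_smul, (ih l _ hl').1 (by simpa using h0), smul_zero]
        · intro q hq
          rw [(ih _ b (by simpa using hl')).1, smul_zero]
          rw [sum_set_add _ _ _ (Finset.mem_range.mp hq)]
          exact h0
      · intro h0
        rw [add_smul, Finset.sum_smul, List.length_map]
        congr 1
        · refine Finset.sum_congr rfl fun q hq => ?_
          have hs := sum_set_add y l q (Finset.mem_range.mp hq)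
          rw [(ih _ b (by simpa using hl')).2 (by rw [hs]; exact h0), hs, smul_smul, hD,
            List.map_set]
          simp [val]
        · by_cases hy0 : 0 < y.1
          · rw [hpos _ _ hy0, map_zero, if_neg hy0.ne', zero_smul]
          · obtain ⟨y1, y2⟩ := y
            obtain rfl : y1 = 0 := by simp only at hy hy0; omega
            rw [hzero, map_smul, (ih l _ hl').2 (by simpa using h0), if_pos rfl, smul_smul]
            simp only [AddSubgroup.coe_add]
            rw [add_comm (y2 : ℂ) (b : ℂ), ← add_assoc, add_comm l.sum.2 y2]

end Words

/-! ### The canonical map to the induced module is injective -/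

section RepHom

variable {M₀ : AddSubgroup ℂ} {E : Type*} [AddCommGroup E] [Module ℂ E]

/-- The representation of `L` given by operators with the commutation relations of `L`. -/
def repHom (ρ : Idx M₀ → Module.End ℂ E) (h : IsRep ρ) : L M₀ →ₗ⁅ℂ⁆ Module.End ℂ E where
  toLinearMap := ext ρ
  map_lie' {x y} := by
    change ext ρ ⁅x, y⁆ = ⁅ext ρ x, ext ρ y⁆
    induction x using induction_d with
    | h0 => simp
    | hadd x x' h h' => simp only [map_add, add_lie, h, h']
    | hsmul c x h => simp only [map_smul, smul_lie, h]
    | hd m =>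
    induction y using induction_d with
    | h0 => simp
    | hadd x x' h h' => simp only [map_add, lie_add, h, h']
    | hsmul c x h => simp only [map_smul, lie_smul, h]
    | hd n =>
    refine LinearMap.ext fun w => ?_
    rw [lie_d, map_smul, ext_d, ext_d, ext_d, LieRing.of_associative_ring_bracket,
      LinearMap.sub_apply, Module.End.mul_apply, Module.End.mul_apply, h m n w, add_sub_cancel_left,
      LinearMap.smul_apply]

theorem repHom_d (ρ : Idx M₀ → Module.End ℂ E) (h : IsRep ρ) (m : Idx M₀) :
    repHom ρ h (d m) = ρ m := ext_d ρ m

end RepHom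

section Free

variable {M₀ : AddSubgroup ℂ}

/-- Formal words applied to the basis vectors of `V(α, β)`. -/
abbrev Free (M₀ : AddSubgroup ℂ) : Type := (List (Idx M₀) × M₀) →₀ ℂ

/-- Putting a letter in front of a formal word. -/
def pre (m : Idx M₀) : Module.End ℂ (Free M₀) :=
  Finsupp.lmapDomain ℂ ℂ fun p => (m :: p.1, p.2)

theorem pre_single (m : Idx M₀) (l : List (Idx M₀)) (b : M₀) :
    pre m (Finsupp.single (l, b) 1) = Finsupp.single (m :: l, b) 1 := by
  simp [pre]

/-- The empty word applied to an element of `V(α, β)`. -/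
def top : V M₀ →ₗ[ℂ] Free M₀ := extV fun b => Finsupp.single ([], b) 1

/-- The value of the operator of `d_m` on a formal word: negative letters are put in front, the
others are moved to the right. -/
def freeVal (α β : ℂ) : List (Idx M₀) → M₀ → Idx M₀ → Free M₀
  | [], b, m => if m.1 < 0 then Finsupp.single ([m], b) 1 else top (act α β (d m) (v b))
  | n :: l, b, m => if m.1 < 0 then Finsupp.single (m :: n :: l, b) 1 else
      pre n (freeVal α β l b m) + (val n - val m) • freeVal α β l b (m + n)

/-- The operator of `d_m` on formal words. -/
def freeOp (α β : ℂ) (m : Idx M₀) : Module.End ℂ (Free M₀) :=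
  Finsupp.linearCombination ℂ fun p => freeVal α β p.1 p.2 m

theorem freeOp_single (α β : ℂ) (m : Idx M₀) (l : List (Idx M₀)) (b : M₀) :
    freeOp α β m (Finsupp.single (l, b) 1) = freeVal α β l b m := by
  simp [freeOp]

theorem free_ext {W : Type*} [AddCommGroup W] [Module ℂ W] {f g : Free M₀ →ₗ[ℂ] W}
    (h : ∀ l b, f (Finsupp.single (l, b) 1) = g (Finsupp.single (l, b) 1)) : f = g :=
  Finsupp.lhom_ext' fun p => LinearMap.ext_ring (h p.1 p.2)

theorem freeOp_of_neg (α β : ℂ) {m : Idx M₀} (hm : m.1 < 0) : freeOp α β m = pre m := by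
  refine free_ext fun l b => ?_
  rw [freeOp_single, pre_single]
  cases l <;> simp [freeVal, hm]

theorem freeOp_pre (α β : ℂ) {m : Idx M₀} (hm : 0 ≤ m.1) (n : Idx M₀) (z : Free M₀) :
    freeOp α β m (pre n z) = pre n (freeOp α β m z) + (val n - val m) • freeOp α β (m + n) z := by
  have : freeOp α β m ∘ₗ pre n
      = pre n ∘ₗ freeOp α β m + (val n - val m) • freeOp α β (m + n) := by
    refine free_ext fun l b => ?_
    simp only [LinearMap.comp_apply, LinearMap.add_apply, LinearMap.smul_apply, pre_single,
      freeOp_single]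
    rw [freeVal, if_neg hm.not_gt]
  exact LinearMap.congr_fun this z

theorem freeOp_top (α β : ℂ) {m : Idx M₀} (hm : 0 ≤ m.1) (w : V M₀) :
    freeOp α β m (top w) = top (act α β (d m) w) := by
  have : freeOp α β m ∘ₗ top = top ∘ₗ act α β (d m) := by
    refine homV_ext fun b => ?_
    rw [LinearMap.comp_apply, LinearMap.comp_apply, top, extV_v, freeOp_single, freeVal,
      if_neg hm.not_gt, top]
  exact LinearMap.congr_fun this w

/-- For negative `n` this is the rule by which `freeVal` moves `m` past a letter. For nonnegative
`n`, induction on the word ends at the relations of `V(α, β)`, and the inductive step is an identity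
of Jacobi type. Only pairs of negative letters are left without a relation. -/
theorem freeOp_comm (α β : ℂ) {m : Idx M₀} (hm : 0 ≤ m.1) (n : Idx M₀) (z : Free M₀) :
    freeOp α β m (freeOp α β n z)
      = freeOp α β n (freeOp α β m z) + (val n - val m) • freeOp α β (m + n) z := by
  have hsingle : ∀ (l : List (Idx M₀)) (b : M₀) (m n : Idx M₀), 0 ≤ m.1 →
      freeOp α β m (freeOp α β n (Finsupp.single (l, b) 1))
      = freeOp α β n (freeOp α β m (Finsupp.single (l, b) 1))
        + (val n - val m) • freeOp α β (m + n) (Finsupp.single (l, b) 1) := by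
    intro l b
    induction l with
    | nil =>
      intro m n hm
      rcases lt_or_ge n.1 0 with hn | hn
      · rw [freeOp_of_neg α β hn, freeOp_pre α β hm]
      · have h0 : (Finsupp.single ([], b) 1 : Free M₀) = top (v b) := by rw [top, extV_v]
        have h := LinearMap.congr_fun (act_lie_d α β m n hm hn) (v b)
        rw [lie_d, map_smul, LinearMap.smul_apply, LinearMap.sub_apply, Module.End.mul_apply,
          Module.End.mul_apply] at h
        rw [h0, freeOp_top α β hn, freeOp_top α β hm, freeOp_top α β hm, freeOp_top α β hn,
          freeOp_top α β (add_nonneg hm hn), ← map_smul, h, ← map_add, add_sub_cancel]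
    | cons x l ih =>
      intro m n hm
      rcases lt_or_ge n.1 0 with hn | hn
      · rw [freeOp_of_neg α β hn, freeOp_pre α β hm]
      · rw [← pre_single, freeOp_pre α β hn, freeOp_pre α β hm, map_add, map_add, map_smul,
          map_smul, freeOp_pre α β hm, freeOp_pre α β hn, freeOp_pre α β (add_nonneg hm hn),
          ih m n hm, ih m (n + x) hm, map_add, map_smul, ih n (m + x) hn, add_left_comm n m x,
          add_assoc m n x, val_add, val_add, val_add]
        module
  have : freeOp α β m ∘ₗ freeOp α β n
      = freeOp α β n ∘ₗ freeOp α β m + (val n - val m) • freeOp α β (m + n) :=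
    free_ext fun l b => hsingle l b m n hm
  exact LinearMap.congr_fun this z

/-- The failure of the commutation relation between two operators. -/
def defect (α β : ℂ) (x y : Idx M₀) (z : Free M₀) : Free M₀ :=
  freeOp α β x (freeOp α β y z) - freeOp α β y (freeOp α β x z)
    - (val y - val x) • freeOp α β (x + y) z

/-- The subspace generated by the failures of the commutation relations. -/
def defects (M₀ : AddSubgroup ℂ) (α β : ℂ) : Submodule ℂ (Free M₀) :=
  Submodule.span ℂ {t | ∃ (l : List (Idx M₀)) (x y : Idx M₀) (z : Free M₀),
    (∀ m ∈ l, m.1 < 0) ∧ x.1 < 0 ∧ y.1 < 0 ∧ t = word (freeOp α β) l (defect α β x y z)}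

/-- If either index is nonnegative the defect vanishes by `freeOp_comm`, so negative pairs suffice
as generators. -/
theorem defect_mem (α β : ℂ) (x y : Idx M₀) (z : Free M₀) :
    defect α β x y z ∈ defects M₀ α β := by
  rcases lt_or_ge x.1 0 with hx | hx
  · rcases lt_or_ge y.1 0 with hy | hy
    · exact Submodule.subset_span ⟨[], x, y, z, by simp, hx, hy, rfl⟩
    · have : defect α β x y z = 0 := by
        rw [defect, freeOp_comm α β hy x, add_comm y x]
        module
      rw [this]
      exact Submodule.zero_mem _
  · have : defect α β x y z = 0 := by
      rw [defect, freeOp_comm α β hx y]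
      module
    rw [this]
    exact Submodule.zero_mem _

theorem freeOp_mem_defects_of_neg (α β : ℂ) {m : Idx M₀} (hm : m.1 < 0) {t : Free M₀}
    (ht : t ∈ defects M₀ α β) : freeOp α β m t ∈ defects M₀ α β := by
  induction ht using Submodule.span_induction with
  | mem t ht =>
    obtain ⟨l, x, y, z, hl, hx, hy, rfl⟩ := ht
    rw [← word_cons]
    exact Submodule.subset_span ⟨m :: l, x, y, z, by simpa [hm] using hl, hx, hy, rfl⟩
  | zero => rw [map_zero]; exact Submodule.zero_mem _
  | add _ _ _ _ h h' => rw [map_add]; exact Submodule.add_mem _ h h'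
  | smul c _ _ h => rw [map_smul]; exact Submodule.smul_mem _ c h

/-- The Jacobi identity: a nonnegative operator acts on defects as a derivation. -/
theorem freeOp_defect (α β : ℂ) {m : Idx M₀} (hm : 0 ≤ m.1) (x y : Idx M₀) (z : Free M₀) :
    freeOp α β m (defect α β x y z) = defect α β x y (freeOp α β m z)
      + (val x - val m) • defect α β (m + x) y z + (val y - val m) • defect α β x (m + y) z := by
  simp only [defect, map_sub, map_smul]
  rw [freeOp_comm α β hm x, freeOp_comm α β hm y z, freeOp_comm α β hm y, freeOp_comm α β hm x z,
    freeOp_comm α β hm (x + y), map_add, map_add, map_smul, map_smul, add_left_comm x m y,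
    ← add_assoc m x y, val_add, val_add, val_add]
  module

/-- A nonnegative operator is moved right through the negative letters to the defect. The
commutators on the way have indices of either sign, so the induction runs over all `m` at once. -/
theorem freeOp_mem_defects (α β : ℂ) (m : Idx M₀) {t : Free M₀} (ht : t ∈ defects M₀ α β) :
    freeOp α β m t ∈ defects M₀ α β := by
  induction ht using Submodule.span_induction with
  | mem t ht =>
    obtain ⟨l, x, y, z, hl, hx, hy, rfl⟩ := ht
    induction l generalizing m with
    | nil =>
      rcases lt_or_ge m.1 0 with hm | hm
      · exact freeOp_mem_defects_of_neg α β hm (defect_mem α β x y z)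
      · rw [word_nil, freeOp_defect α β hm]
        exact add_mem (add_mem (defect_mem _ _ _ _ _)
          (Submodule.smul_mem _ _ (defect_mem _ _ _ _ _)))
          (Submodule.smul_mem _ _ (defect_mem _ _ _ _ _))
    | cons n l ih =>
      have hn : n.1 < 0 := hl n (by simp)
      have hl' : ∀ k ∈ l, k.1 < 0 := fun k hk => hl k (by simp [hk])
      rcases lt_or_ge m.1 0 with hm | hm
      · exact freeOp_mem_defects_of_neg α β hm
          (Submodule.subset_span ⟨n :: l, x, y, z, hl, hx, hy, rfl⟩)
      · rw [word_cons, freeOp_comm α β hm]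
        exact add_mem (freeOp_mem_defects_of_neg α β hn (ih m hl'))
          (Submodule.smul_mem _ _ (ih _ hl'))
  | zero => rw [map_zero]; exact Submodule.zero_mem _
  | add _ _ _ _ h h' => rw [map_add]; exact Submodule.add_mem _ h h'
  | smul c _ _ h => rw [map_smul]; exact Submodule.smul_mem _ c h

/-- The part of an element that has no letters. -/
def topPart : Free M₀ →ₗ[ℂ] V M₀ :=
  Finsupp.linearCombination ℂ fun p => if p.1 = [] then v p.2 else 0

theorem topPart_top (w : V M₀) : topPart (top w) = w := by
  have : topPart ∘ₗ top = (LinearMap.id : V M₀ →ₗ[ℂ] V M₀) := by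
    refine homV_ext fun b => ?_
    rw [LinearMap.comp_apply, top, extV_v]
    simp [topPart]
  exact LinearMap.congr_fun this w

theorem topPart_pre (m : Idx M₀) (z : Free M₀) : topPart (pre m z) = 0 := by
  have : topPart ∘ₗ pre m = (0 : Free M₀ →ₗ[ℂ] V M₀) := by
    refine free_ext fun l b => ?_
    rw [LinearMap.comp_apply, pre_single]
    simp [topPart]
  exact LinearMap.congr_fun this z

/-- Every term of a generator begins with a negative letter, so dividing by the defects leaves the
top level intact. -/
theorem defects_le_ker (α β : ℂ) : defects M₀ α β ≤ LinearMap.ker topPart := by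
  refine Submodule.span_le.mpr ?_
  rintro _ ⟨l, x, y, z, hl, hx, hy, rfl⟩
  rw [SetLike.mem_coe, LinearMap.mem_ker]
  cases l with
  | nil =>
    rw [word_nil, defect, freeOp_of_neg α β hx, freeOp_of_neg α β hy,
      freeOp_of_neg α β (show (x + y).1 < 0 from add_neg hx hy)]
    simp [topPart_pre]
  | cons n l => rw [word_cons, freeOp_of_neg α β (hl n (by simp)), topPart_pre]

/-- The operator of `d_m` on the quotient by the failures of the commutation relations. -/
def quotOp (α β : ℂ) (m : Idx M₀) : Module.End ℂ (Free M₀ ⧸ defects M₀ α β) :=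
  (defects M₀ α β).mapQ (defects M₀ α β) (freeOp α β m) fun _ ht => freeOp_mem_defects α β m ht

theorem isRep_quotOp (α β : ℂ) : IsRep (quotOp (M₀ := M₀) α β) := by
  intro m n w
  obtain ⟨z, rfl⟩ := Submodule.mkQ_surjective _ w
  simp only [quotOp, Submodule.mkQ_apply, Submodule.mapQ_apply]
  rw [← Submodule.Quotient.mk_smul, ← Submodule.Quotient.mk_add, Submodule.Quotient.eq,
    ← sub_sub]
  exact defect_mem α β m n z

/-- The comparison map from `U(L) ⊗ V(α, β)`. -/
def compare (α β : ℂ) : U M₀ ⊗[ℂ] V M₀ →ₗ[ℂ] Free M₀ ⧸ defects M₀ α β :=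
  TensorProduct.lift (((UniversalEnvelopingAlgebra.lift ℂ
    (repHom _ (isRep_quotOp (M₀ := M₀) α β))).toLinearMap).compl₂ ((defects M₀ α β).mkQ ∘ₗ top))

theorem compare_smul (α β : ℂ) (u : U M₀) (t : U M₀ ⊗[ℂ] V M₀) :
    compare α β (u • t) = UniversalEnvelopingAlgebra.lift ℂ
      (repHom _ (isRep_quotOp (M₀ := M₀) α β)) u (compare α β t) := by
  induction t using TensorProduct.induction_on with
  | zero => simp
  | add x y hx hy => rw [smul_add, map_add, hx, hy, map_add, map_add]
  | tmul x y =>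
    rw [TensorProduct.smul_tmul']
    simp [compare]

theorem compare_tmul_ι (α β : ℂ) (m : Idx M₀) (t : U M₀ ⊗[ℂ] V M₀) :
    compare α β (UniversalEnvelopingAlgebra.ι ℂ (d m) • t) = quotOp α β m (compare α β t) := by
  rw [compare_smul, UniversalEnvelopingAlgebra.lift_ι_apply, repHom_d]

theorem compare_one_tmul (α β : ℂ) (w : V M₀) :
    compare α β (1 ⊗ₜ w) = (defects M₀ α β).mkQ (top w) := by
  simp [compare]

theorem compare_indRel (α β : ℂ) {t : U M₀ ⊗[ℂ] V M₀} (ht : t ∈ indRel M₀ α β) :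
    compare α β t = 0 := by
  induction ht using Submodule.span_induction with
  | mem t ht =>
    obtain ⟨⟨x, hx⟩, w, rfl⟩ := ht
    rw [map_sub, sub_eq_zero]
    change compare α β (UniversalEnvelopingAlgebra.ι ℂ x ⊗ₜ[ℂ] w)
      = compare α β (1 ⊗ₜ[ℂ] act α β x w)
    have h1 : UniversalEnvelopingAlgebra.ι ℂ x ⊗ₜ[ℂ] w
        = UniversalEnvelopingAlgebra.ι ℂ x • ((1 : U M₀) ⊗ₜ[ℂ] w) := by
      rw [TensorProduct.smul_tmul', smul_eq_mul, mul_one]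
    rw [h1, compare_smul, UniversalEnvelopingAlgebra.lift_ι_apply, compare_one_tmul,
      compare_one_tmul]
    change x ∈ Submodule.span ℂ (d '' {m : Idx M₀ | 0 ≤ m.1}) at hx
    clear h1
    induction hx using Submodule.span_induction with
    | mem x hx =>
      obtain ⟨m, hm, rfl⟩ := hx
      rw [repHom_d, ← freeOp_top α β hm]
      rfl
    | zero => simp
    | add _ _ _ _ h h' => simp only [map_add, LinearMap.add_apply, h, h']
    | smul c _ _ h => simp only [map_smul, LinearMap.smul_apply, h]
  | zero => rw [map_zero]
  | add _ _ _ _ h h' => rw [map_add, h, h', add_zero]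
  | smul c _ _ h => rw [compare_smul, h, map_zero]

/-- The projection of the induced module to its top level. -/
theorem exists_proj (M₀ : AddSubgroup ℂ) (α β : ℂ) : ∃ π : Vtilde M₀ α β →ₗ[ℂ] V M₀,
    (∀ w, π (emb M₀ α β w) = w) ∧
    ∀ m : Idx M₀, m.1 < 0 → ∀ w, π (UniversalEnvelopingAlgebra.ι ℂ (d m) • w) = 0 := by
  let Θ : U M₀ ⊗[ℂ] V M₀ →ₗ[ℂ] V M₀ :=
    (defects M₀ α β).liftQ topPart (defects_le_ker α β) ∘ₗ compare α β
  have hΘ : (indRel M₀ α β).restrictScalars ℂ ≤ LinearMap.ker Θ := by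
    intro t ht
    rw [LinearMap.mem_ker, LinearMap.comp_apply, compare_indRel α β ht, map_zero]
  let π : Vtilde M₀ α β →ₗ[ℂ] V M₀ :=
    (((indRel M₀ α β).restrictScalars ℂ).liftQ Θ hΘ) ∘ₗ
      (Submodule.Quotient.restrictScalarsEquiv ℂ (indRel M₀ α β)).symm.toLinearMap
  have hπ : ∀ t, π ((indRel M₀ α β).mkQ t) = Θ t := fun t => rfl
  refine ⟨π, fun w => ?_, fun m hm w => ?_⟩
  · change Θ (1 ⊗ₜ[ℂ] w) = w
    rw [LinearMap.comp_apply, compare_one_tmul]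
    exact topPart_top w
  · obtain ⟨t, rfl⟩ := Submodule.mkQ_surjective _ w
    rw [← map_smul, hπ, LinearMap.comp_apply, compare_tmul_ι]
    obtain ⟨z, hz⟩ := Submodule.mkQ_surjective _ (compare α β t)
    rw [← hz]
    change topPart (freeOp α β m z) = 0
    rw [freeOp_of_neg α β hm, topPart_pre]

end Free

/-! ### Shift operators on polynomials -/

section Poly

open MvPolynomial

variable {σ : Type*}

/-- The polynomials all of whose monomials have degree less than `N`. -/
def low (σ : Type*) (N : ℤ) : Submodule ℂ (MvPolynomial σ ℂ) :=
  restrictSupport ℂ {e | (e.degree : ℤ) < N}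

theorem low_mono {N N' : ℤ} (h : N ≤ N') : low σ N ≤ low σ N' :=
  restrictSupport_mono ℂ fun _ he => lt_of_lt_of_le he h

theorem monomial_mem_low {e : σ →₀ ℕ} {N : ℤ} (h : (e.degree : ℤ) < N) (c : ℂ) :
    monomial e c ∈ low σ N := by
  classical
  intro e' he'
  have := support_monomial_subset he'
  rw [Finset.mem_singleton] at this
  subst this
  exact h

theorem low_eq_bot {N : ℤ} (h : N ≤ 0) : low σ N = ⊥ := by
  rw [eq_bot_iff]
  intro p hp
  rw [Submodule.mem_bot, ← support_eq_empty, Finset.eq_empty_iff_forall_notMem]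
  intro e he
  have : (e.degree : ℤ) < N := hp he
  omega

theorem mem_low_of_totalDegree_lt {p : MvPolynomial σ ℂ} {N : ℕ} (h : p.totalDegree < N) :
    p ∈ low σ N := by
  intro e he
  have h1 : e.degree ≤ p.totalDegree := by
    have := le_totalDegree he
    rwa [Finsupp.degree_apply]
  have : (e.degree : ℤ) < N := by exact_mod_cast lt_of_le_of_lt h1 h
  exact this

theorem low_induction {N : ℤ} (f : Module.End ℂ (MvPolynomial σ ℂ))
    (S : Submodule ℂ (MvPolynomial σ ℂ))
    (h : ∀ e : σ →₀ ℕ, (e.degree : ℤ) < N → f (monomial e 1) ∈ S) {p : MvPolynomial σ ℂ}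
    (hp : p ∈ low σ N) : f p ∈ S := by
  rw [p.as_sum, map_sum]
  refine Submodule.sum_mem _ fun e he => ?_
  have : monomial e (coeff e p) = coeff e p • monomial e (1 : ℂ) := by
    rw [smul_monomial, smul_eq_mul, mul_one]
  rw [this, map_smul]
  exact Submodule.smul_mem _ _ (h e (hp he))

theorem mul_X_mem_low {N : ℤ} (k : σ) {p : MvPolynomial σ ℂ} (hp : p ∈ low σ N) :
    p * X k ∈ low σ (N + 1) := by
  refine low_induction (LinearMap.mulRight ℂ (X k)) _ (fun e he => ?_) hp
  rw [LinearMap.mulRight_apply, X, monomial_mul]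
  refine monomial_mem_low ?_ _
  rw [map_add, Finsupp.degree_single]
  push_cast
  linarith

theorem C_mul_mem_low {N : ℤ} (c : ℂ) {p : MvPolynomial σ ℂ} (hp : p ∈ low σ N) :
    C c * p ∈ low σ N := by
  rw [← smul_eq_C_mul]
  exact Submodule.smul_mem _ _ hp

theorem pderiv_mem_low {N : ℤ} (j : σ) {p : MvPolynomial σ ℂ} (hp : p ∈ low σ N) :
    pderiv j p ∈ low σ (N - 1) := by
  refine low_induction (pderiv j).toLinearMap _ (fun e he => ?_) hp
  change pderiv j (monomial e 1) ∈ _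
  rw [pderiv_monomial]
  by_cases h0 : e j = 0
  · simp [h0]
  · refine monomial_mem_low ?_ _
    have h1 : e - Finsupp.single j 1 + Finsupp.single j 1 = e := by
      ext k
      by_cases hk : j = k
      · subst hk; simp; omega
      · simp [Finsupp.single_eq_of_ne' hk]
    have h2 := congrArg Finsupp.degree h1
    rw [map_add, Finsupp.degree_single] at h2
    have : ((e - Finsupp.single j 1).degree : ℤ) + 1 = e.degree := by exact_mod_cast h2
    linarith

/-- Monomials are eigenvectors of the Euler operator with their degree as eigenvalue; subtracting
`N` removes exactly the part of degree `N`. -/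
theorem euler_mem_low [Fintype σ] {N : ℕ} {p : MvPolynomial σ ℂ} (hp : p ∈ low σ (N + 1)) :
    ∑ j, pderiv j p * X j - C (N : ℂ) * p ∈ low σ N := by
  let f : Module.End ℂ (MvPolynomial σ ℂ) :=
    ∑ j, (LinearMap.mulRight ℂ (X j)) ∘ₗ (pderiv (R := ℂ) j).toLinearMap - (N : ℂ) • LinearMap.id
  have hf : ∀ p, f p = ∑ j, pderiv j p * X j - (N : ℂ) • p := fun p => by simp [f]
  have := low_induction (N := (N : ℤ) + 1) f (low σ N) (fun e he => ?_) hp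
  · rwa [hf, smul_eq_C_mul] at this
  · have h1 : ∑ j, pderiv j (monomial e (1 : ℂ)) * X j = e.degree • monomial e (1 : ℂ) := by
      rw [← (isHomogeneous_monomial (R := ℂ) 1 (rfl : e.degree = e.degree)).sum_X_mul_pderiv]
      exact Finset.sum_congr rfl fun j _ => mul_comm _ _
    rw [hf, h1, ← Nat.cast_smul_eq_nsmul ℂ, ← sub_smul]
    rcases eq_or_ne e.degree N with h | h
    · rw [h, sub_self, zero_smul]
      exact Submodule.zero_mem _
    · exact Submodule.smul_mem _ _ (monomial_mem_low (by omega) _)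

/-- Rank-nullity for reduction modulo `low σ N`; the image is the space of leading forms of degree
`N`. -/
theorem rank_inf_low_succ (E : Submodule ℂ (MvPolynomial σ ℂ)) (N : ℕ) :
    Module.rank ℂ ↥(E ⊓ low σ (N + 1)) =
      Module.rank ℂ ((E ⊓ low σ (N + 1)).map (low σ N).mkQ) + Module.rank ℂ ↥(E ⊓ low σ N) := by
  rw [← LinearMap.rank_range_add_rank_ker ((low σ N).mkQ.domRestrict (E ⊓ low σ (N + 1))),
    LinearMap.range_domRestrict]
  have hle : E ⊓ low σ N ≤ E ⊓ low σ (N + 1) := inf_le_inf le_rfl (low_mono (by linarith))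
  have hker : LinearMap.ker ((low σ N).mkQ.domRestrict (E ⊓ low σ (N + 1)))
      = (E ⊓ low σ N).comap (E ⊓ low σ (N + 1)).subtype := by
    ext ⟨p, hp⟩
    simpa using fun _ => hp.1
  rw [hker, (Submodule.comapSubtypeEquivOfLe hle).rank_eq]

variable [DecidableEq σ]

/-- The substitution `X_j ↦ X_j + x`. -/
def shift (j : σ) (x : ℂ) : MvPolynomial σ ℂ →ₐ[ℂ] MvPolynomial σ ℂ :=
  aeval fun k => X k + C (Pi.single (M := fun _ => ℂ) j x k)

theorem eval_shift (j : σ) (x : ℂ) (c : σ → ℂ) (p : MvPolynomial σ ℂ) :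
    eval c (shift j x p) = eval (c + Pi.single j x) p := by
  induction p using MvPolynomial.induction_on with
  | C a => simp [shift]
  | add p q hp hq => rw [map_add, map_add, map_add, hp, hq]
  | mul_X p k hp => rw [map_mul, map_mul, map_mul, hp]; simp [shift]

/-- The remainder of the first order Taylor expansion of `shift`. -/
def remainder (j : σ) (x : ℂ) : Module.End ℂ (MvPolynomial σ ℂ) :=
  (shift j x).toLinearMap - LinearMap.id - x • (pderiv j).toLinearMap

theorem remainder_apply (j : σ) (x : ℂ) (p : MvPolynomial σ ℂ) :
    remainder j x p = shift j x p - p - C x * pderiv j p := by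
  rw [← smul_eq_C_mul]; rfl

theorem remainder_mul_X (j k : σ) (x : ℂ) (p : MvPolynomial σ ℂ) :
    remainder j x (p * X k) = remainder j x p * X k
      + if k = j then C x * (remainder j x p + C x * pderiv j p) else 0 := by
  simp only [remainder_apply, map_mul, Derivation.leibniz, smul_eq_mul, pderiv_X]
  by_cases h : k = j
  · subst h
    simp [shift]
    ring
  · simp [shift, h]
    ring

/-- By `remainder_mul_X`, multiplying by a variable raises the degree bound of the remainder by one
only, so it stays two below that of the polynomial. -/
theorem remainder_mem_low {N : ℤ} (j : σ) (x : ℂ) {p : MvPolynomial σ ℂ} (hp : p ∈ low σ N) :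
    remainder j x p ∈ low σ (N - 2) := by
  refine low_induction _ _ (fun e he => ?_) hp
  -- The induction on monomials hides the exponent; homogeneity is carried along to identify `n`
  -- with the degree afterwards.
  have key : ∀ (e : σ →₀ ℕ) (a : ℂ), ∃ n : ℕ, (monomial e a).IsHomogeneous n ∧
      monomial e a ∈ low σ (n + 1) ∧ remainder j x (monomial e a) ∈ low σ (n - 1) := by
    refine MvPolynomial.induction_on_monomial (motive := fun p => ∃ n : ℕ, p.IsHomogeneous n ∧
      p ∈ low σ (n + 1) ∧ remainder j x p ∈ low σ (n - 1)) ?_ ?_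
    · intro a
      refine ⟨0, isHomogeneous_C _ _, monomial_mem_low (by simp) _, ?_⟩
      have : remainder j x (C a) = 0 := by simp [remainder_apply, shift]
      rw [this]
      exact Submodule.zero_mem _
    · rintro p k ⟨n, hn, hlow, hrem⟩
      refine ⟨n + 1, hn.mul (isHomogeneous_X _ _), by simpa using mul_X_mem_low k hlow, ?_⟩
      rw [remainder_mul_X]
      have h1 : ((n + 1 : ℕ) : ℤ) - 1 = (n : ℤ) - 1 + 1 := by push_cast; ring
      rw [h1]
      refine add_mem (mul_X_mem_low k hrem) ?_
      split_ifs
      · refine C_mul_mem_low _ (add_mem (low_mono (by linarith) hrem) (C_mul_mem_low _ ?_))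
        have := pderiv_mem_low j hlow
        exact low_mono (by linarith) this
      · exact Submodule.zero_mem _
  obtain ⟨n, hn, -, hrem⟩ := key e 1
  have : n = e.degree := hn.inj_right (isHomogeneous_monomial _ rfl) (by simp)
  subst this
  exact low_mono (by linarith) hrem

/-- The action of `d_x`, with `x ∈ M₀`, in terms of polynomials. -/
def polyOp [Fintype σ] (a x : ℂ) (p : MvPolynomial σ ℂ) : MvPolynomial σ ℂ :=
  (C a + ∑ j, X j) * p + ∑ j, (C (x - 1) - X j) * shift j x p

theorem eval_polyOp [Fintype σ] (a x : ℂ) (c : σ → ℂ) (p : MvPolynomial σ ℂ) :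
    eval c (polyOp a x p) = (a + ∑ j, c j) * eval c p
      + ∑ j, (x - 1 - c j) * eval (c + Pi.single j x) p := by
  simp [polyOp, eval_shift]

/-- Expand `shift` to first order. The products with `∑ X j` cancel, order zero gives `a + card σ *
(x - 1)`, and the first derivatives times `X j` give `-x N` by `euler_mem_low`. -/
theorem polyOp_sub_mem_low [Fintype σ] (a x : ℂ) {N : ℕ} {p : MvPolynomial σ ℂ}
    (hp : p ∈ low σ (N + 1)) :
    polyOp a x p - (a + Fintype.card σ * (x - 1) - x * N) • p ∈ low σ N := by
  have h : polyOp a x p - (a + Fintype.card σ * (x - 1) - x * N) • p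
      = -(C x * (∑ j, pderiv j p * X j - C (N : ℂ) * p))
        + ∑ j, (C (x - 1) * (C x * pderiv j p)
          + (C (x - 1) * remainder j x p - remainder j x p * X j)) := by
    have h1 : ∀ j : σ, (C (x - 1) - X j) * shift j x p
        = (C (x - 1) * (C x * pderiv j p)
          + (C (x - 1) * remainder j x p - remainder j x p * X j))
          + C (x - 1) * p - X j * p - C x * (pderiv j p * X j) := by
      intro j
      rw [remainder_apply]
      ring
    rw [polyOp, Finset.sum_congr rfl fun j _ => h1 j, Finset.sum_sub_distrib,
      Finset.sum_sub_distrib, Finset.sum_add_distrib, Finset.sum_const, Finset.card_univ,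
      ← Finset.sum_mul, ← Finset.mul_sum, smul_eq_C_mul]
    simp only [nsmul_eq_mul, map_sub, map_add, map_mul, map_natCast, map_one]
    ring
  rw [h]
  refine add_mem (neg_mem (C_mul_mem_low _ (euler_mem_low hp))) (Submodule.sum_mem _ fun j _ => ?_)
  have hr := remainder_mem_low j x hp
  refine add_mem (C_mul_mem_low _ (C_mul_mem_low _ (low_mono (by linarith) (pderiv_mem_low j hp))))
    (sub_mem (C_mul_mem_low _ (low_mono (by linarith) hr)) ?_)
  exact low_mono (by linarith) (mul_X_mem_low j hr)

variable {M₀ : AddSubgroup ℂ}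

/-- An affine function with nonzero slope has at most one zero, and a constant one that is nonzero
at `t` has none. -/
theorem finite_zeros {a b : ℂ} {t : M₀} (ht : a + t * b ≠ 0) :
    {u : M₀ | a + (u : ℂ) * b = 0}.Finite := by
  refine Set.Subsingleton.finite fun u hu u' hu' => ?_
  rw [Set.mem_ofPred_eq] at hu hu'
  have h : ((u : ℂ) - u') * b = 0 := by linear_combination hu - hu'
  rcases mul_eq_zero.mp h with h | rfl
  · exact Subtype.ext (sub_eq_zero.mp h)
  · exact absurd (by simpa using hu) (by simpa using ht)

/-- A family of spaces of polynomials of bounded degree that is stable under `polyOp` has constant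
rank away from the weight zero. -/
theorem rank_eq_of_polyOp [Fintype σ] [Infinite M₀] (α β : ℂ)
    (E : M₀ → Submodule ℂ (MvPolynomial σ ℂ))
    (hE : ∀ x s : M₀, ∀ p ∈ E s, polyOp (s + α + x * β) x p ∈ E (x + s)) (B : ℕ)
    (hB : ∀ s, E s ≤ low σ B) {s t : M₀} (hs : (s : ℂ) + α - Fintype.card σ ≠ 0)
    (ht : (t : ℂ) + α - Fintype.card σ ≠ 0) : Module.rank ℂ (E s) = Module.rank ℂ (E t) := by
  have hstep : ∀ (N : ℕ) (x s : M₀),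
      (s : ℂ) + α - Fintype.card σ + x * (β + Fintype.card σ - N) ≠ 0 →
      (E s ⊓ low σ (N + 1)).map (low σ N).mkQ ≤ (E (x + s) ⊓ low σ (N + 1)).map (low σ N).mkQ := by
    intro N x s h
    rintro _ ⟨p, ⟨hp1, hp2⟩, rfl⟩
    have h1 := polyOp_sub_mem_low (s + α + x * β) x hp2
    have h2 : (s : ℂ) + α + x * β + Fintype.card σ * (x - 1) - x * N
        = (s : ℂ) + α - Fintype.card σ + x * (β + Fintype.card σ - N) := by ring
    rw [h2] at h1
    set κ := (s : ℂ) + α - Fintype.card σ + x * (β + Fintype.card σ - N)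
    -- Dividing by the scalar `κ` gives an element with the same leading form as `p`.
    refine ⟨κ⁻¹ • polyOp (s + α + x * β) x p, ⟨Submodule.smul_mem _ _ (hE x s p hp1), ?_⟩, ?_⟩
    · refine Submodule.smul_mem _ _ ?_
      rw [← sub_add_cancel (polyOp (s + α + x * β) x p) (κ • p)]
      exact add_mem (low_mono (by linarith) h1) (Submodule.smul_mem _ _ hp2)
    · rw [Submodule.mkQ_apply, Submodule.mkQ_apply, Submodule.Quotient.eq]
      have : κ⁻¹ • polyOp (s + α + x * β) x p - p
          = κ⁻¹ • (polyOp (s + α + x * β) x p - κ • p) := by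
        rw [smul_sub, smul_smul, inv_mul_cancel₀ h, one_smul]
      rw [this]
      exact Submodule.smul_mem _ _ h1
  have hle : ∀ (N : ℕ) (s t : M₀), (s : ℂ) + α - Fintype.card σ ≠ 0 →
      (t : ℂ) + α - Fintype.card σ ≠ 0 →
      (E s ⊓ low σ (N + 1)).map (low σ N).mkQ ≤ (E t ⊓ low σ (N + 1)).map (low σ N).mkQ := by
    intro N s t hs ht
    set γ := β + Fintype.card σ - N with hγ
    -- The scalars of the steps from `s` to `u` and from `u` to `t` are affine in `u`; `hf` and `hg`
    -- are their values at `u = s` and `u = t`.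
    have hf : ((s : ℂ) + α - Fintype.card σ - s * γ) + s * γ ≠ 0 := by simpa using hs
    have hg : (α - Fintype.card σ + t * γ) + t * (1 - γ) ≠ 0 := by
      convert ht using 1; ring
    obtain ⟨u, hu⟩ := ((finite_zeros hf).union (finite_zeros hg)).exists_notMem
    rw [Set.mem_union, not_or] at hu
    have h1 := hstep N (u - s) s (fun h => hu.1 (by
      rw [Set.mem_ofPred_eq, ← h, AddSubgroup.coe_sub]; ring))
    have h2 := hstep N (t - u) u (fun h => hu.2 (by
      rw [Set.mem_ofPred_eq, ← h, AddSubgroup.coe_sub]; ring))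
    rw [sub_add_cancel] at h1 h2
    exact h1.trans h2
  have hrank : ∀ N : ℕ, Module.rank ℂ ↥(E s ⊓ low σ N) = Module.rank ℂ ↥(E t ⊓ low σ N) := by
    intro N
    induction N with
    | zero => rw [low_eq_bot (by simp), inf_bot_eq, inf_bot_eq]
    | succ N ih =>
      push_cast
      rw [rank_inf_low_succ, rank_inf_low_succ, ih,
        le_antisymm (hle N s t hs ht) (hle N t s ht hs)]
  have := hrank B
  rwa [inf_eq_left.mpr (hB s), inf_eq_left.mpr (hB t)] at this

end Poly

/-! ### Weight vectors -/

section Spectral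

variable {E κ : Type*} [AddCommGroup E] [Module ℂ E] {T : Module.End ℂ E} {e : κ → E} {μ : κ → ℂ}

theorem aeval_eigenvector {x : E} {ν : ℂ} (h : T x = ν • x) (f : Polynomial ℂ) :
    Polynomial.aeval T f x = f.eval ν • x := by
  induction f using Polynomial.induction_on' with
  | add p q hp hq => rw [map_add, LinearMap.add_apply, hp, hq, Polynomial.eval_add, add_smul]
  | monomial n a =>
    have hpow : (T ^ n) x = ν ^ n • x := by
      induction n with
      | zero => simp
      | succ n ih => rw [pow_succ', Module.End.mul_apply, ih, map_smul, h, smul_smul, pow_succ]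
    rw [Polynomial.aeval_monomial, Module.End.mul_apply, hpow, Polynomial.eval_monomial,
      Module.algebraMap_end_apply, smul_smul]

theorem exists_polynomial_eval (G : Finset ℂ) (χ : ℂ → ℂ) :
    ∃ f : Polynomial ℂ, ∀ z ∈ G, f.eval z = χ z :=
  ⟨Lagrange.interpolate G id χ, fun _ hz =>
    Lagrange.eval_interpolate_at_node χ (Set.injOn_id _) hz⟩

/-- A Lagrange polynomial in `T`, equal to `1` at `ν` and `0` at the other eigenvalues involved,
fixes `x` and kills the unwanted terms. The `e k` need not be independent. -/
theorem mem_span_of_eigenvector (hT : ∀ k, T (e k) = μ k • e k)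
    (hspan : Submodule.span ℂ (Set.range e) = ⊤) {x : E} {ν : ℂ} (hx : T x = ν • x) :
    x ∈ Submodule.span ℂ (e '' {k | μ k = ν}) := by
  classical
  obtain ⟨c, hc⟩ := Finsupp.mem_span_range_iff_exists_finsupp.mp
    (hspan ▸ Submodule.mem_top : x ∈ Submodule.span ℂ (Set.range e))
  obtain ⟨f, hf⟩ := exists_polynomial_eval (insert ν (c.support.image μ)) (Pi.single ν 1)
  have h1 : Polynomial.aeval T f x = x := by
    rw [aeval_eigenvector hx, hf ν (Finset.mem_insert_self _ _), Pi.single_eq_same, one_smul]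
  rw [← h1, ← hc, Finsupp.sum, map_sum]
  refine Submodule.sum_mem _ fun k hk => ?_
  rw [map_smul, aeval_eigenvector (hT k),
    hf (μ k) (Finset.mem_insert_of_mem (Finset.mem_image_of_mem _ hk))]
  by_cases h : μ k = ν
  · exact Submodule.smul_mem _ _ (Submodule.smul_mem _ _ (Submodule.subset_span ⟨k, h, rfl⟩))
  · rw [Pi.single_eq_of_ne h, zero_smul, smul_zero]
    exact Submodule.zero_mem _

/-- Only finitely many eigenvalues occur in `x`, so on `x` the map `p` agrees with a polynomial in
`T`. -/
theorem proj_mem_of_stable (hT : ∀ k, T (e k) = μ k • e k)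
    (hspan : Submodule.span ℂ (Set.range e) = ⊤) {p : Module.End ℂ E} {χ : ℂ → ℂ}
    (hp : ∀ k, p (e k) = χ (μ k) • e k) {N : Submodule ℂ E} (hN : ∀ x ∈ N, T x ∈ N) {x : E}
    (hx : x ∈ N) : p x ∈ N := by
  classical
  obtain ⟨c, hc⟩ := Finsupp.mem_span_range_iff_exists_finsupp.mp
    (hspan ▸ Submodule.mem_top : x ∈ Submodule.span ℂ (Set.range e))
  obtain ⟨f, hf⟩ := exists_polynomial_eval (c.support.image μ) χ
  have h1 : p x = Polynomial.aeval T f x := by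
    rw [← hc, Finsupp.sum, map_sum, map_sum]
    refine Finset.sum_congr rfl fun k hk => ?_
    rw [map_smul, map_smul, aeval_eigenvector (hT k), hp, hf _ (Finset.mem_image_of_mem _ hk)]
  rw [h1]
  have hstable : ∀ f : Polynomial ℂ, Polynomial.aeval T f x ∈ N := by
    intro f
    induction f using Polynomial.induction_on' with
    | add p q hp hq => rw [map_add]; exact N.add_mem hp hq
    | monomial n a =>
      rw [Polynomial.aeval_monomial, Module.End.mul_apply, Module.algebraMap_end_apply]
      refine N.smul_mem _ ?_
      induction n with
      | zero => simpa using hx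
      | succ n ih => rw [pow_succ', Module.End.mul_apply]; exact hN _ ih
  exact hstable f

end Spectral

/-! ### Separation of weights and levels of words -/

section Index

variable {M₀ : AddSubgroup ℂ}

theorem val_injective (hdisj : Disjoint (AddSubgroup.zmultiples (1 : ℂ)) M₀) :
    Function.Injective (val : Idx M₀ → ℂ) := by
  rintro ⟨i, a⟩ ⟨j, b⟩ h
  simp only [val] at h
  have h1 : ((i - j : ℤ) : ℂ) = ((b - a : M₀) : ℂ) := by
    push_cast
    linear_combination h
  have h2 : ((i - j : ℤ) : ℂ) = 0 := by
    refine AddSubgroup.disjoint_def.mp hdisj (AddSubgroup.mem_zmultiples_iff.mpr ⟨i - j, by simp⟩) ?_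
    rw [h1]
    exact (b - a).2
  have hij : i = j := by
    have : i - j = 0 := by exact_mod_cast h2
    omega
  subst hij
  exact Prod.ext rfl (Subtype.ext (by simpa using h))

theorem fst_sum_add_length_le {l : List (Idx M₀)} (hl : ∀ m ∈ l, m.1 < 0) :
    l.sum.1 + l.length ≤ 0 := by
  induction l with
  | nil => simp
  | cons m l ih =>
    have h1 := ih fun k hk => hl k (by simp [hk])
    have h2 := hl m (by simp)
    rw [List.sum_cons, Prod.fst_add, List.length_cons]
    push_cast
    linarith

end Index

/-! ### Modules generated by a top level -/

section Modules

variable {M₀ : AddSubgroup ℂ} {E : Type*} [AddCommGroup E] [Module ℂ E] [Module (U M₀) E]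
  [IsScalarTower ℂ (U M₀) E]

/-- The operator of `d_m` on an `L`-module. -/
def opr (E : Type*) [AddCommGroup E] [Module ℂ E] [Module (U M₀) E] [IsScalarTower ℂ (U M₀) E]
    (m : Idx M₀) : Module.End ℂ E :=
  Algebra.lsmul ℂ ℂ E (UniversalEnvelopingAlgebra.ι ℂ (d m) : U M₀)

theorem opr_apply (m : Idx M₀) (w : E) :
    opr E m w = (UniversalEnvelopingAlgebra.ι ℂ (d m) : U M₀) • w := rfl

theorem isRep_opr : IsRep (opr (M₀ := M₀) E) := by
  intro m n w
  have h := (UniversalEnvelopingAlgebra.ι ℂ (L := L M₀)).map_lie (d m) (d n)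
  rw [lie_d, map_smul, LieRing.of_associative_ring_bracket] at h
  simp only [opr_apply, ← mul_smul]
  rw [← smul_assoc, h, sub_smul, add_sub_cancel]

/-- The elements preserving `S` form a subalgebra containing `L`; by the universal property it is
all of `U(L)`. -/
theorem smul_mem_of_opr {S : Submodule ℂ E} (hS : ∀ (m : Idx M₀), ∀ w ∈ S, opr E m w ∈ S)
    (u : U M₀) {w : E} (hw : w ∈ S) : u • w ∈ S := by
  let A : Subalgebra ℂ (U M₀) :=
    { carrier := {u | ∀ w ∈ S, u • w ∈ S}
      mul_mem' := fun {a b} ha hb w hw => by rw [mul_smul]; exact ha _ (hb _ hw)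
      add_mem' := fun {a b} ha hb w hw => by rw [add_smul]; exact S.add_mem (ha _ hw) (hb _ hw)
      algebraMap_mem' := fun c w hw => by rw [algebraMap_smul]; exact S.smul_mem _ hw }
  have hι : ∀ x : L M₀, UniversalEnvelopingAlgebra.ι ℂ x ∈ A := by
    intro x
    induction x using induction_d with
    | h0 => rw [map_zero]; exact A.zero_mem
    | hadd y z hy hz => rw [map_add]; exact A.add_mem hy hz
    | hsmul c y hy => rw [map_smul]; exact A.smul_mem hy c
    | hd m => exact fun w hw => hS m w hw
  let f : L M₀ →ₗ⁅ℂ⁆ A :=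
    { toFun := fun x => ⟨UniversalEnvelopingAlgebra.ι ℂ x, hι x⟩
      map_add' := fun x y => Subtype.ext (map_add _ x y)
      map_smul' := fun c x => Subtype.ext (map_smul _ c x)
      map_lie' := fun {x y} => Subtype.ext (LieHom.map_lie _ x y) }
  have h : A.val.comp (UniversalEnvelopingAlgebra.lift ℂ f) = AlgHom.id ℂ (U M₀) := by
    refine UniversalEnvelopingAlgebra.hom_ext ℂ (LieHom.ext fun x => ?_)
    change ((UniversalEnvelopingAlgebra.lift ℂ f (UniversalEnvelopingAlgebra.ι ℂ x) : A) : U M₀)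
      = UniversalEnvelopingAlgebra.ι ℂ x
    rw [UniversalEnvelopingAlgebra.lift_ι_apply]
    rfl
  have hu : u ∈ A := by
    have := AlgHom.congr_fun h u
    rw [AlgHom.id_apply] at this
    rw [← this]
    exact (UniversalEnvelopingAlgebra.lift ℂ f u).2
  exact hu w hw

/-- The vectors `e b` generate the module and satisfy the relations of the basis vectors of
`V(α, β)`. -/
structure IsTop (α β : ℂ) (e : M₀ → E) : Prop where
  pos : ∀ (m : Idx M₀) (b : M₀), 0 < m.1 → opr E m (e b) = 0
  zero : ∀ a b : M₀, opr E (0, a) (e b) = ((b : ℂ) + α + (a : ℂ) * β) • e (a + b)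
  gen : Submodule.span (U M₀) (Set.range e) = ⊤

/-- A word with negative letters and an index of a top vector. -/
abbrev NegWord (M₀ : AddSubgroup ℂ) : Type := {l : List (Idx M₀) // ∀ m ∈ l, m.1 < 0} × M₀

/-- The index of the weight of a word. -/
def NegWord.idx (k : NegWord M₀) : Idx M₀ := k.1.1.sum + (0, k.2)

/-- The vector given by a word. -/
def NegWord.vec (e : M₀ → E) (k : NegWord M₀) : E := word (opr E) k.1.1 (e k.2)

namespace IsTop

variable {α β : ℂ} {e : M₀ → E}

theorem opr_zero_vec (h : IsTop α β e) (k : NegWord M₀) :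
    opr E (0 : Idx M₀) (k.vec e) = (val k.idx + α) • k.vec e := by
  obtain ⟨⟨l, hl⟩, b⟩ := k
  simp only [NegWord.idx, NegWord.vec]
  clear hl
  induction l with
  | nil =>
    rw [word_nil, List.sum_nil, zero_add]
    have := h.zero 0 b
    rw [zero_add] at this
    refine this.trans ?_
    simp [val]
  | cons m l ih =>
    rw [word_cons, isRep_opr, ih, map_smul, zero_add, ← add_smul, List.sum_cons]
    congr 1
    rw [add_assoc m, val_add m]
    simp [val]
    ring

/-- Nonnegative operators are commuted to the right until they meet a top vector. For a spanning set
the negative letters need no ordering. -/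
theorem span_vec (h : IsTop α β e) :
    Submodule.span ℂ (Set.range fun k : NegWord M₀ => k.vec e) = ⊤ := by
  set S := Submodule.span ℂ (Set.range fun k : NegWord M₀ => k.vec e) with hS
  have hvec : ∀ k : NegWord M₀, k.vec e ∈ S := fun k => Submodule.subset_span ⟨k, rfl⟩
  have hneg : ∀ m : Idx M₀, m.1 < 0 → ∀ w ∈ S, opr E m w ∈ S := by
    intro m hm w hw
    induction hw using Submodule.span_induction with
    | mem w hw =>
      obtain ⟨⟨⟨l, hl⟩, b⟩, rfl⟩ := hw
      have := hvec ⟨⟨m :: l, by simpa [hm] using hl⟩, b⟩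
      simpa only [NegWord.vec, word_cons] using this
    | zero => rw [map_zero]; exact S.zero_mem
    | add _ _ _ _ h h' => rw [map_add]; exact S.add_mem h h'
    | smul c _ _ h => rw [map_smul]; exact S.smul_mem c h
  have hword : ∀ (l : List (Idx M₀)) (_ : ∀ m ∈ l, m.1 < 0) (b : M₀) (m : Idx M₀),
      opr E m (word (opr E) l (e b)) ∈ S := by
    intro l hl b
    induction l with
    | nil =>
      intro m
      rcases lt_trichotomy m.1 0 with hm | hm | hm
      · exact hneg m hm _ (hvec ⟨⟨[], by simp⟩, b⟩)
      · obtain ⟨m1, a⟩ := m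
        obtain rfl : m1 = 0 := hm
        rw [word_nil, h.zero]
        exact S.smul_mem _ (hvec ⟨⟨[], by simp⟩, a + b⟩)
      · rw [word_nil, h.pos m b hm]
        exact S.zero_mem
    | cons n l ih =>
      intro m
      have ih' := ih fun k hk => hl k (by simp [hk])
      rw [word_cons, isRep_opr]
      exact S.add_mem (hneg n (hl n (by simp)) _ (ih' m)) (S.smul_mem _ (ih' _))
  have hopr : ∀ m : Idx M₀, ∀ w ∈ S, opr E m w ∈ S := by
    intro m w hw
    induction hw using Submodule.span_induction with
    | mem w hw =>
      obtain ⟨⟨⟨l, hl⟩, b⟩, rfl⟩ := hw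
      exact hword l hl b m
    | zero => rw [map_zero]; exact S.zero_mem
    | add _ _ _ _ h h' => rw [map_add]; exact S.add_mem h h'
    | smul c _ _ h => rw [map_smul]; exact S.smul_mem c h
  rw [eq_top_iff]
  intro w _
  have hw : w ∈ Submodule.span (U M₀) (Set.range e) := h.gen ▸ Submodule.mem_top
  induction hw using Submodule.span_induction with
  | mem w hw =>
    obtain ⟨b, rfl⟩ := hw
    exact hvec ⟨⟨[], by simp⟩, b⟩
  | zero => exact S.zero_mem
  | add _ _ _ _ h h' => exact S.add_mem (h trivial) (h' trivial)
  | smul u _ _ h => exact smul_mem_of_opr hopr u (h trivial)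

theorem mem_span_of_weight (h : IsTop α β e)
    (hdisj : Disjoint (AddSubgroup.zmultiples (1 : ℂ)) M₀) {w : E} {n : Idx M₀}
    (hw : opr E (0 : Idx M₀) w = (val n + α) • w) :
    w ∈ Submodule.span ℂ ((fun k : NegWord M₀ => k.vec e) '' {k | k.idx = n}) := by
  refine Submodule.span_mono (Set.image_mono fun k hk => ?_)
    (mem_span_of_eigenvector (μ := fun k : NegWord M₀ => val k.idx + α) h.opr_zero_vec
      h.span_vec hw)
  exact val_injective hdisj (add_right_cancel hk)

theorem eq_zero_of_pos (h : IsTop α β e)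
    (hdisj : Disjoint (AddSubgroup.zmultiples (1 : ℂ)) M₀) {w : E} {n : Idx M₀} (hn : 0 < n.1)
    (hw : opr E (0 : Idx M₀) w = (val n + α) • w) : w = 0 := by
  have := h.mem_span_of_weight hdisj hw
  have hempty : {k : NegWord M₀ | k.idx = n} = ∅ := by
    rw [Set.eq_empty_iff_forall_notMem]
    rintro ⟨⟨l, hl⟩, b⟩ rfl
    have := fst_sum_add_length_le hl
    simp only [NegWord.idx, Prod.fst_add, add_zero] at hn
    omega
  simpa [hempty] using this

/-- A word of negative level is nonempty, so it lies in the image of a negative operator. -/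
theorem apply_eq_zero_of_neg {W : Type*} [AddCommGroup W] [Module ℂ W] (h : IsTop α β e)
    (hdisj : Disjoint (AddSubgroup.zmultiples (1 : ℂ)) M₀) {π : E →ₗ[ℂ] W}
    (hπ : ∀ m : Idx M₀, m.1 < 0 → ∀ w, π (opr E m w) = 0) {w : E} {n : Idx M₀} (hn : n.1 < 0)
    (hw : opr E (0 : Idx M₀) w = (val n + α) • w) : π w = 0 := by
  have hmem := h.mem_span_of_weight hdisj hw
  have hle : Submodule.span ℂ ((fun k : NegWord M₀ => k.vec e) '' {k | k.idx = n})
      ≤ LinearMap.ker π := by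
    refine Submodule.span_le.mpr ?_
    rintro _ ⟨⟨⟨l, hl⟩, b⟩, rfl, rfl⟩
    rw [SetLike.mem_coe, LinearMap.mem_ker]
    cases l with
    | nil => simp [NegWord.idx] at hn
    | cons m l =>
      simp only [NegWord.vec, word_cons]
      exact hπ m (hl m (by simp)) _
  exact hle hmem

end IsTop

theorem opr_weight {α : ℂ} {w : E} {n : Idx M₀} (m : Idx M₀)
    (hw : opr E (0 : Idx M₀) w = (val n + α) • w) :
    opr E (0 : Idx M₀) (opr E m w) = (val (m + n) + α) • opr E m w := by
  rw [isRep_opr, hw, map_smul, zero_add, ← add_smul, val_add]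
  congr 1
  simp [val]
  ring

/-- The vectors that are killed by all products of `k` operators from `L₁`. -/
def sing (M₀ : AddSubgroup ℂ) (E : Type*) [AddCommGroup E] [Module ℂ E] [Module (U M₀) E]
    [IsScalarTower ℂ (U M₀) E] : ℕ → Submodule ℂ E
  | 0 => ⊥
  | k + 1 => ⨅ c : M₀, (sing M₀ E k).comap (opr E ((1, c) : Idx M₀))

theorem mem_sing_succ {k : ℕ} {w : E} :
    w ∈ sing M₀ E (k + 1) ↔ ∀ c : M₀, opr E ((1, c) : Idx M₀) w ∈ sing M₀ E k := by
  simp [sing]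

theorem mem_sing_of_word {k : ℕ} {w : E}
    (h : ∀ c : List M₀, c.length = k → word (opr E) (c.map fun a => ((1, a) : Idx M₀)) w = 0) :
    w ∈ sing M₀ E k := by
  induction k generalizing w with
  | zero => simpa [sing] using h [] rfl
  | succ k ih =>
    refine mem_sing_succ.mpr fun a => ih fun c hc => ?_
    have := h (c ++ [a]) (by simp [hc])
    rwa [List.map_append, word_append] at this

/-- This is where `L₁` generates `L₊`: inductively, each operator of level above `1` is a multiple
of a commutator with an element of `L₁`. -/
theorem opr_pos_mem_sing (hM₀ : M₀ ≠ ⊥) (j : ℕ) :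
    ∀ (k : ℕ) (a : M₀) (w : E), w ∈ sing M₀ E (k + (j + 1)) →
      opr E (((j + 1 : ℕ), a) : Idx M₀) w ∈ sing M₀ E k := by
  induction j with
  | zero =>
    intro k a w hw
    exact mem_sing_succ.mp hw a
  | succ j ih =>
    intro k a w hw
    -- The structure constant is `j + a - 2b`; it cannot vanish both at `b = 0` and at a nonzero
    -- `b`.
    obtain ⟨b, hb⟩ : ∃ b : M₀, val (((j + 1 : ℕ), a - b) : Idx M₀) - val ((1, b) : Idx M₀) ≠ 0 := by
      by_contra! hall
      refine hM₀ ((AddSubgroup.eq_bot_iff_forall _).mpr fun x hx => ?_)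
      have h1 := hall 0
      have h2 := hall ⟨x, hx⟩
      simp only [val, AddSubgroup.coe_sub, AddSubgroup.coe_zero] at h1 h2
      linear_combination (h1 - h2) / 2
    have hcomm := isRep_opr (E := E) ((1, b) : Idx M₀) (((j + 1 : ℕ), a - b) : Idx M₀) w
    have hidx : ((1, b) : Idx M₀) + (((j + 1 : ℕ), a - b) : Idx M₀) = (((j + 1 + 1 : ℕ), a) : Idx M₀) := by
      refine Prod.ext ?_ ?_
      · simp only [Prod.fst_add]; push_cast; ring
      · simp
    rw [hidx] at hcomm
    have h1 : opr E ((1, b) : Idx M₀) (opr E (((j + 1 : ℕ), a - b) : Idx M₀) w) ∈ sing M₀ E k :=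
      mem_sing_succ.mp (ih (k + 1) (a - b) w (by rwa [add_right_comm k 1 (j + 1), add_assoc])) b
    have h2 : opr E (((j + 1 : ℕ), a - b) : Idx M₀) (opr E ((1, b) : Idx M₀) w) ∈ sing M₀ E k :=
      ih k _ _ (mem_sing_succ.mp (by rwa [add_assoc k]) b)
    have h3 := Submodule.sub_mem _ h1 h2
    rw [hcomm, add_sub_cancel_left] at h3
    exact ((sing M₀ E k).smul_mem_iff hb).mp h3

/-- Moving an element of `L₁` past the operator leaves a term with smaller `k` and a commutator with
smaller `j`, hence induction on `k + j`. For `j = 0` the commutator is itself in `L₁`. -/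
theorem opr_nonpos_mem_sing (n : ℕ) :
    ∀ (k j : ℕ) (a : M₀) (w : E), k + j = n → w ∈ sing M₀ E k →
      opr E ((-(j : ℤ), a) : Idx M₀) w ∈ sing M₀ E (k + j) := by
  induction n with
  | zero =>
    intro k j a w hn hw
    obtain rfl : k = 0 := by omega
    obtain rfl : w = 0 := by simpa [sing] using hw
    rw [map_zero]
    exact Submodule.zero_mem _
  | succ n ih =>
    intro k j a w hn hw
    cases k with
    | zero =>
      obtain rfl : w = 0 := by simpa [sing] using hw
      rw [map_zero]
      exact Submodule.zero_mem _
    | succ k =>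
      rw [add_right_comm k 1 j]
      refine mem_sing_succ.mpr fun c => ?_
      rw [isRep_opr]
      refine Submodule.add_mem _ (ih k j a _ (by omega) (mem_sing_succ.mp hw c))
        (Submodule.smul_mem _ _ ?_)
      cases j with
      | zero =>
        have := mem_sing_succ.mp hw (c + a)
        simpa using this
      | succ j =>
        have := ih (k + 1) j (c + a) w (by omega) hw
        have hidx : ((1, c) : Idx M₀) + ((-((j + 1 : ℕ) : ℤ), a) : Idx M₀)
            = ((-(j : ℤ), c + a) : Idx M₀) := by
          refine Prod.ext ?_ rfl
          simp only [Prod.fst_add]; push_cast; ring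
        rw [hidx, ← add_assoc, add_right_comm]
        exact this

/-- In a module without submodules that are invisible from the top level, a weight vector of level
`-k` is zero when all products of `k` operators from `L₁` kill it. -/
theorem IsTop.eq_zero_of_mem_sing {W : Type*} [AddCommGroup W] [Module ℂ W] {α β : ℂ} {e : M₀ → E}
    (h : IsTop α β e) (hM₀ : M₀ ≠ ⊥) (hdisj : Disjoint (AddSubgroup.zmultiples (1 : ℂ)) M₀)
    {π : E →ₗ[ℂ] W} (hπ : ∀ m : Idx M₀, m.1 < 0 → ∀ w, π (opr E m w) = 0)
    (hfaith : ∀ w, (∀ u : U M₀, π (u • w) = 0) → w = 0) {k : ℕ} {s : M₀} {w : E}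
    (hw : opr E (0 : Idx M₀) w = (val ((-(k : ℤ), s) : Idx M₀) + α) • w)
    (hsing : w ∈ sing M₀ E k) : w = 0 := by
  -- Level and depth are tied together: operators shift both alike, so `A` is stable, and at level
  -- `0` it contains only zero. Hence `π` vanishes on its span.
  let A : Set E := {x | ∃ (k : ℕ) (s : M₀), x ∈ sing M₀ E k ∧
    opr E (0 : Idx M₀) x = (val ((-(k : ℤ), s) : Idx M₀) + α) • x}
  have hA : ∀ m : Idx M₀, ∀ x ∈ A, opr E m x ∈ A := by
    rintro ⟨n, a⟩ x ⟨k, s, hx, hxw⟩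
    have hwt := opr_weight ((n, a) : Idx M₀) hxw
    rcases le_or_gt n 0 with hn | hn
    · obtain ⟨j, rfl⟩ : ∃ j : ℕ, n = -(j : ℤ) := ⟨n.natAbs, by omega⟩
      refine ⟨k + j, a + s, opr_nonpos_mem_sing _ k j a x rfl hx, ?_⟩
      rw [hwt, Prod.mk_add_mk]
      congr 4
      push_cast; ring
    · rcases le_or_gt n k with hnk | hnk
      · obtain ⟨j, rfl⟩ : ∃ j : ℕ, n = ((j + 1 : ℕ) : ℤ) := ⟨n.natAbs - 1, by omega⟩
        obtain ⟨k, rfl⟩ : ∃ k', k = k' + (j + 1) := ⟨k - (j + 1), by omega⟩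
        refine ⟨k, a + s, opr_pos_mem_sing hM₀ j k a x hx, ?_⟩
        rw [hwt, Prod.mk_add_mk]
        congr 4
        push_cast; ring
      · have h0 : opr E ((n, a) : Idx M₀) x = 0 :=
          h.eq_zero_of_pos hdisj (by simp only [Prod.mk_add_mk]; omega) hwt
        rw [h0]
        exact ⟨0, 0, Submodule.zero_mem _, by simp⟩
  have hspan : ∀ m : Idx M₀, ∀ x ∈ Submodule.span ℂ A, opr E m x ∈ Submodule.span ℂ A := by
    intro m x hx
    induction hx using Submodule.span_induction with
    | mem x hx => exact Submodule.subset_span (hA m x hx)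
    | zero => rw [map_zero]; exact Submodule.zero_mem _
    | add _ _ _ _ h h' => rw [map_add]; exact Submodule.add_mem _ h h'
    | smul c _ _ h => rw [map_smul]; exact Submodule.smul_mem _ c h
  have hker : Submodule.span ℂ A ≤ LinearMap.ker π := by
    refine Submodule.span_le.mpr ?_
    rintro x ⟨k, s, hx, hxw⟩
    rw [SetLike.mem_coe, LinearMap.mem_ker]
    cases k with
    | zero =>
      obtain rfl : x = 0 := by simpa [sing] using hx
      exact map_zero π
    | succ k => exact h.apply_eq_zero_of_neg hdisj hπ (by simp only; omega) hxw
  exact hfaith w fun u => hker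
    (smul_mem_of_opr hspan u (Submodule.subset_span ⟨k, s, hsing, hw⟩))

end Modules

/-! ### The quotient by the largest submodule avoiding the top level -/

section Quotient

variable (M₀ : AddSubgroup ℂ) (α β : ℂ)

theorem emb_rho (x : nonneg M₀) (w : V M₀) :
    UniversalEnvelopingAlgebra.ι ℂ (x : L M₀) • emb M₀ α β w = emb M₀ α β (rho M₀ α β x w) := by
  change UniversalEnvelopingAlgebra.ι ℂ (x : L M₀) • (indRel M₀ α β).mkQ (1 ⊗ₜ[ℂ] w)
    = (indRel M₀ α β).mkQ (1 ⊗ₜ[ℂ] rho M₀ α β x w)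
  rw [← map_smul, ← sub_eq_zero, ← map_sub, Submodule.mkQ_apply, Submodule.Quotient.mk_eq_zero,
    TensorProduct.smul_tmul', smul_eq_mul, mul_one]
  exact Submodule.subset_span ⟨x, w, rfl⟩

theorem d_smul_emb {m : Idx M₀} (hm : 0 ≤ m.1) (w : V M₀) :
    (UniversalEnvelopingAlgebra.ι ℂ (d m) : U M₀) • emb M₀ α β w
      = emb M₀ α β (act α β (d m) w) :=
  emb_rho M₀ α β ⟨d m, Submodule.subset_span ⟨m, hm, rfl⟩⟩ w

theorem isTop_emb : IsTop α β fun b : M₀ => emb M₀ α β (v b) where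
  pos m b hm := by
    rw [opr_apply, d_smul_emb M₀ α β hm.le, act_d_of_ne α β m hm.ne', LinearMap.zero_apply,
      map_zero]
  zero a b := by rw [opr_apply, d_smul_emb M₀ α β le_rfl, act_d, map_smul]
  gen := by
    set S := Submodule.span (U M₀) (Set.range fun b : M₀ => emb M₀ α β (v b))
    have hemb : ∀ w : V M₀, emb M₀ α β w ∈ S := by
      intro w
      refine Finsupp.induction_linear w ?_ ?_ ?_
      · exact (map_zero (emb M₀ α β)).symm ▸ S.zero_mem
      · intro x y hx hy
        exact (map_add (emb M₀ α β) x y).symm ▸ S.add_mem hx hy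
      · intro b c
        have h : (Finsupp.single b c : M₀ →₀ ℂ) = c • Finsupp.single b (1 : ℂ) := by simp
        rw [h]
        exact (map_smul (emb M₀ α β) c (v b)).symm ▸
          (S.restrictScalars ℂ).smul_mem c (Submodule.subset_span ⟨b, rfl⟩)
    rw [eq_top_iff]
    intro x _
    obtain ⟨t, rfl⟩ := Submodule.mkQ_surjective _ x
    induction t using TensorProduct.induction_on with
    | zero => rw [map_zero]; exact S.zero_mem
    | add x y hx hy => rw [map_add]; exact S.add_mem (hx trivial) (hy trivial)
    | tmul u w =>
      have h : u ⊗ₜ[ℂ] w = u • ((1 : U M₀) ⊗ₜ[ℂ] w) := by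
        rw [TensorProduct.smul_tmul', smul_eq_mul, mul_one]
      rw [h, map_smul]
      exact S.smul_mem u (hemb w)

variable {M₀ α β}

/-- On weight vectors `emb ∘ π` is the projection to the weights of level `0`, so on each vector it
is a polynomial in `d₀`. -/
theorem proj_mem (hdisj : Disjoint (AddSubgroup.zmultiples (1 : ℂ)) M₀)
    {π : Vtilde M₀ α β →ₗ[ℂ] V M₀} (hπ : ∀ w, π (emb M₀ α β w) = w)
    (hneg : ∀ m : Idx M₀, m.1 < 0 → ∀ w, π (UniversalEnvelopingAlgebra.ι ℂ (d m) • w) = 0)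
    (N : Submodule (U M₀) (Vtilde M₀ α β)) {x : Vtilde M₀ α β} (hx : x ∈ N) :
    emb M₀ α β (π x) ∈ N := by
  classical
  have htop := isTop_emb M₀ α β
  refine proj_mem_of_stable (N := N.restrictScalars ℂ) (p := emb M₀ α β ∘ₗ π)
    (χ := fun z => if ∃ b : M₀, z = val ((0, b) : Idx M₀) + α then 1 else 0)
    htop.opr_zero_vec htop.span_vec ?_ (fun y hy => N.smul_mem _ hy) hx
  rintro ⟨⟨l, hl⟩, b⟩
  cases l with
  | nil =>
    rw [if_pos ⟨b, by simp [NegWord.idx]⟩, one_smul]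
    simp only [NegWord.vec, word_nil, LinearMap.comp_apply, hπ]
  | cons m l =>
    rw [if_neg, zero_smul]
    · simp only [NegWord.vec, word_cons, LinearMap.comp_apply, opr_apply]
      rw [hneg m (hl m (by simp)), map_zero]
    · rintro ⟨b', hb'⟩
      have h1 := congrArg Prod.fst (val_injective hdisj (add_right_cancel hb'))
      have h2 := fst_sum_add_length_le hl
      simp only [NegWord.idx, Prod.fst_add, add_zero] at h1
      rw [h1, List.length_cons] at h2
      push_cast at h2
      omega

/-- By `proj_mem`, `π` vanishes on any submodule that avoids the top level. Conversely, the vectors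
invisible to `π` form such a submodule, because `π` splits `emb`. -/
theorem mem_J_iff (hdisj : Disjoint (AddSubgroup.zmultiples (1 : ℂ)) M₀)
    {π : Vtilde M₀ α β →ₗ[ℂ] V M₀} (hπ : ∀ w, π (emb M₀ α β w) = w)
    (hneg : ∀ m : Idx M₀, m.1 < 0 → ∀ w, π (UniversalEnvelopingAlgebra.ι ℂ (d m) • w) = 0)
    (x : Vtilde M₀ α β) : x ∈ J M₀ α β ↔ ∀ u : U M₀, π (u • x) = 0 := by
  let K : Submodule (U M₀) (Vtilde M₀ α β) :=
    { carrier := {x | ∀ u : U M₀, π (u • x) = 0}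
      zero_mem' := fun u => by rw [smul_zero, map_zero]
      add_mem' := fun {x y} hx hy u => by rw [smul_add, map_add, hx u, hy u, add_zero]
      smul_mem' := fun c x hx u => by rw [smul_smul]; exact hx _ }
  have hK : J M₀ α β = K := by
    refine le_antisymm (sSup_le fun N hN x hx u => ?_) (le_sSup ?_)
    · have h1 := proj_mem hdisj hπ hneg N (N.smul_mem u hx)
      have h2 : emb M₀ α β (π (u • x)) = 0 := by
        rw [← Submodule.mem_bot ℂ, ← (hN : _ = _)]
        exact ⟨h1, LinearMap.mem_range_self _ _⟩
      rw [← hπ (π (u • x)), h2, map_zero]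
    · refine (Submodule.eq_bot_iff _).mpr ?_
      rintro _ ⟨hx, w, rfl⟩
      have := (hx : ∀ u : U M₀, π (u • emb M₀ α β w) = 0) 1
      rw [one_smul, hπ] at this
      rw [this, map_zero]
  rw [hK]
  rfl

variable (M₀ α β)

/-- The image of `v b` in `V̄(α, β)`. -/
def vbar (b : M₀) : Vbar M₀ α β := (J M₀ α β).mkQ (emb M₀ α β (v b))

theorem isTop_vbar : IsTop α β (vbar M₀ α β) where
  pos m b hm := by
    have := (isTop_emb M₀ α β).pos m b hm
    rw [opr_apply] at this ⊢
    rw [vbar, ← map_smul, this, map_zero]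
  zero a b := by
    have := (isTop_emb M₀ α β).zero a b
    rw [opr_apply] at this ⊢
    rw [vbar, ← map_smul, this]
    rfl
  gen := by
    have h := congrArg (Submodule.map (J M₀ α β).mkQ) (isTop_emb M₀ α β).gen
    rw [Submodule.map_span, Submodule.map_top, Submodule.range_mkQ, ← Set.range_comp] at h
    exact h

theorem exists_proj_vbar (hdisj : Disjoint (AddSubgroup.zmultiples (1 : ℂ)) M₀) :
    ∃ π : Vbar M₀ α β →ₗ[ℂ] V M₀, (∀ b, π (vbar M₀ α β b) = v b) ∧
      (∀ m : Idx M₀, m.1 < 0 → ∀ w, π (opr _ m w) = 0) ∧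
      ∀ w, (∀ u : U M₀, π (u • w) = 0) → w = 0 := by
  obtain ⟨π, hπ, hneg⟩ := exists_proj M₀ α β
  have hJ := mem_J_iff hdisj hπ hneg
  have hker : (J M₀ α β).restrictScalars ℂ ≤ LinearMap.ker π := by
    intro x hx
    have := (hJ x).mp hx 1
    rwa [one_smul] at this
  let ϖ : Vbar M₀ α β →ₗ[ℂ] V M₀ :=
    (((J M₀ α β).restrictScalars ℂ).liftQ π hker) ∘ₗ
      (Submodule.Quotient.restrictScalarsEquiv ℂ (J M₀ α β)).symm.toLinearMap
  have hϖ : ∀ x, ϖ ((J M₀ α β).mkQ x) = π x := fun _ => rfl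
  refine ⟨ϖ, fun b => (hϖ _).trans (hπ _), fun m hm w => ?_, fun w hw => ?_⟩
  · obtain ⟨x, rfl⟩ := Submodule.mkQ_surjective _ w
    rw [opr_apply, ← map_smul, hϖ, hneg m hm]
  · obtain ⟨x, rfl⟩ := Submodule.mkQ_surjective _ w
    rw [Submodule.mkQ_apply, Submodule.Quotient.mk_eq_zero, hJ]
    intro u
    rw [← hϖ, map_smul, hw]

end Quotient

/-! ### Weight spaces as spaces of polynomials -/

section Polynomials

open MvPolynomial

variable {M₀ : AddSubgroup ℂ} {E : Type*} [AddCommGroup E] [Module ℂ E] [Module (U M₀) E]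
  [IsScalarTower ℂ (U M₀) E] {α β : ℂ} {e : M₀ → E} {i : ℕ}

/-- The word `d_{1+c₁} ⋯ d_{1+cᵢ}`. -/
def oneWord (c : Fin i → M₀) : List (Idx M₀) := List.ofFn fun j => (1, c j)

theorem oneWord_sum (c : Fin i → M₀) : (oneWord c).sum = ((i : ℤ), ∑ j, c j) := by
  rw [oneWord, List.sum_ofFn]
  refine Prod.ext ?_ ?_
  · simp [Prod.fst_sum]
  · simp [Prod.snd_sum]

/-- The polynomial `q` describes how the words `d_{1+c₁} ⋯ d_{1+cᵢ}` act on `w`. -/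
def Describes (e : M₀ → E) (s : M₀) (w : E) (q : MvPolynomial (Fin i) ℂ) : Prop :=
  ∀ c : Fin i → M₀, word (opr E) (oneWord c) w = eval (fun j => (c j : ℂ)) q • e (s + ∑ j, c j)

/-- A polynomial is determined by its values on a power of the infinite set `M₀`. -/
theorem Describes.unique [Infinite M₀] (he : ∀ b, e b ≠ 0) {s : M₀} {w : E}
    {q q' : MvPolynomial (Fin i) ℂ} (h : Describes e s w q) (h' : Describes e s w q') : q = q' := by
  refine funext_set (fun _ => (M₀ : Set ℂ)) (fun _ => Set.infinite_coe_iff.mp ‹_›) fun x hx => ?_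
  have := (h fun j => ⟨x j, hx j trivial⟩).symm.trans (h' fun j => ⟨x j, hx j trivial⟩)
  exact smul_left_injective ℂ (he _) this

theorem describes_vec (h : IsTop α β e) {k : NegWord M₀} {s : M₀} (hk : k.idx = (-(i : ℤ), s)) :
    ∃ q : MvPolynomial (Fin i) ℂ, q.totalDegree ≤ 2 * i ∧ Describes e s (k.vec e) q := by
  obtain ⟨⟨l, hl⟩, b⟩ := k
  have hk1 : l.sum.1 = -(i : ℤ) := by simpa [NegWord.idx] using congrArg Prod.fst hk
  have hk2 : l.sum.2 + b = s := by simpa [NegWord.idx] using congrArg Prod.snd hk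
  -- The variables `X j` stand for the `c j`. The combined word has at most `2 * i` letters, since
  -- each letter of `l` lowers the level by at least one.
  let l' : List (ℤ × MvPolynomial (Fin i) ℂ) :=
    (List.ofFn fun j => ((1 : ℤ), (X j : MvPolynomial (Fin i) ℂ)))
      ++ l.map fun m => (m.1, C (m.2 : ℂ))
  refine ⟨coef (C α) (C β) l' (C (b : ℂ)), ?_, fun c => ?_⟩
  · refine (totalDegree_coef_le α β l'.length l' _ rfl ?_ (by simp)).trans ?_
    · intro y hy
      rcases List.mem_append.mp hy with hy | hy
      · obtain ⟨j, rfl⟩ := List.mem_ofFn.mp hy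
        simp
      · obtain ⟨m, -, rfl⟩ := List.mem_map.mp hy
        simp
    · have := fst_sum_add_length_le hl
      simp only [l', List.length_append, List.length_ofFn, List.length_map]
      omega
  · have hsum : (oneWord c ++ l).sum = (0, ∑ j, c j + l.sum.2) := by
      rw [List.sum_append, oneWord_sum]
      refine Prod.ext ?_ rfl
      simp [hk1]
    have hword := (isRep_opr.word_top h.pos h.zero _ (oneWord c ++ l) b rfl).2 (by rw [hsum])
    rw [word_append, hsum] at hword
    refine hword.trans ?_
    rw [map_coef _ _ _ _ _ _ rfl, ← hk2]
    simp only [eval_C, add_assoc, l', oneWord, List.map_append, List.map_ofFn, List.map_map]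
    rw [← add_assoc, add_comm (∑ j, c j + l.sum.2) b, add_comm (∑ j, c j), add_left_comm b]
    congr 2
    simp [Function.comp_def]

theorem exists_describes (h : IsTop α β e)
    (hdisj : Disjoint (AddSubgroup.zmultiples (1 : ℂ)) M₀) {s : M₀} {w : E}
    (hw : opr E (0 : Idx M₀) w = (val ((-(i : ℤ), s) : Idx M₀) + α) • w) :
    ∃ q : MvPolynomial (Fin i) ℂ, q.totalDegree ≤ 2 * i ∧ Describes e s w q := by
  have hmem := h.mem_span_of_weight hdisj hw
  clear hw
  induction hmem using Submodule.span_induction with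
  | mem w hw =>
    obtain ⟨k, hk, rfl⟩ := hw
    exact describes_vec h hk
  | zero => exact ⟨0, by simp, fun c => by simp⟩
  | add x y _ _ hx hy =>
    obtain ⟨p, hp, hp'⟩ := hx
    obtain ⟨q, hq, hq'⟩ := hy
    exact ⟨p + q, (totalDegree_add _ _).trans (max_le hp hq), fun c => by
      rw [map_add, hp' c, hq' c, map_add, add_smul]⟩
  | smul a x _ hx =>
    obtain ⟨p, hp, hp'⟩ := hx
    exact ⟨a • p, (totalDegree_smul_le _ _).trans hp, fun c => by
      rw [map_smul, hp' c, smul_eval, mul_smul]⟩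

theorem oneWord_set (c : Fin i → M₀) (j : Fin i) (x : M₀) :
    (oneWord c).set j (((0, x) : Idx M₀) + (oneWord c).getD j 0)
      = oneWord (c + Pi.single j x) := by
  refine List.ext_getElem (by simp [oneWord]) fun n h1 h2 => ?_
  have hn : n < i := by simpa [oneWord] using h2
  by_cases hj : (j : ℕ) = n
  · subst hj
    simp [oneWord, add_comm]
  · have : (⟨n, hn⟩ : Fin i) ≠ j := fun h => hj (by rw [← h])
    simp [oneWord, hj, Pi.single_eq_of_ne this]

/-- Merging `d_x` with the `j`-th letter replaces `c j` by `c j + x`, a shift of one variable; the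
term where `d_x` reaches the top vector gives the other summand of `polyOp`. -/
theorem Describes.opr (h : IsTop α β e) {s : M₀} {w : E} {q : MvPolynomial (Fin i) ℂ}
    (hq : Describes e s w q) (x : M₀) :
    Describes e (x + s) (opr E ((0, x) : Idx M₀) w) (polyOp (s + α + x * β) x q) := by
  intro c
  have hcomm := isRep_opr.comm_word ((0, x) : Idx M₀) (oneWord c) w
  rw [← sub_eq_iff_eq_add'] at hcomm
  rw [← hcomm, hq c, map_smul, h.zero]
  have hlen : (oneWord c).length = i := by simp [oneWord]
  rw [hlen, ← Fin.sum_univ_eq_sum_range (fun q => (val ((oneWord c).getD q 0) - val ((0, x) : Idx M₀)) •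
    word (GenVir.opr E) ((oneWord c).set q (((0, x) : Idx M₀) + (oneWord c).getD q 0)) w)]
  have hterm : ∀ j : Fin i, (val ((oneWord c).getD j 0) - val ((0, x) : Idx M₀)) •
      word (GenVir.opr E) ((oneWord c).set j (((0, x) : Idx M₀) + (oneWord c).getD j 0)) w
      = ((1 + c j - x) * eval ((fun j => (c j : ℂ)) + Pi.single j (x : ℂ)) q)
        • e (x + s + ∑ j, c j) := by
    intro j
    rw [oneWord_set, hq, smul_smul]
    have h1 : (fun k => (((c + Pi.single j x : Fin i → M₀) k : M₀) : ℂ))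
        = (fun j => (c j : ℂ)) + Pi.single j (x : ℂ) := by
      funext k
      by_cases hk : k = j
      · subst hk; simp
      · simp [Pi.single_eq_of_ne hk]
    have h2 : s + ∑ k, (c + Pi.single j x : Fin i → M₀) k = x + s + ∑ k, c k := by
      simp only [Pi.add_apply, Finset.sum_add_distrib, Finset.sum_pi_single', Finset.mem_univ,
        if_true]
      abel
    have h3 : val ((oneWord c).getD j 0) = 1 + (c j : ℂ) := by
      simp [oneWord, val]
    rw [h1, h2, h3]
    simp [val]
  rw [Finset.sum_congr rfl fun j _ => hterm j, ← Finset.sum_smul, smul_smul, ← add_assoc x s,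
    ← sub_smul, eval_polyOp]
  congr 1
  rw [sub_eq_add_neg, ← Finset.sum_neg_distrib]
  congr 1
  · push_cast
    ring
  · exact Finset.sum_congr rfl fun j _ => by ring

end Polynomials

theorem mem_wt_iff {M₀ : AddSubgroup ℂ} {α β : ℂ} {i : ℕ} {s : M₀} {w : Vbar M₀ α β} :
    w ∈ wt M₀ α β (-(i : ℂ) + α + s) ↔
      opr _ (0 : Idx M₀) w = (val ((-(i : ℤ), s) : Idx M₀) + α) • w := by
  have h : -(i : ℂ) + α + s = val ((-(i : ℤ), s) : Idx M₀) + α := by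
    simp only [val]
    push_cast
    ring
  rw [h]
  rfl

/-- Weight spaces on the same level have the same dimension when their weights are not zero. -/
theorem rank_wt_eq (M₀ : AddSubgroup ℂ) (hM₀ : M₀ ≠ ⊥)
    (hdisj : Disjoint (AddSubgroup.zmultiples (1 : ℂ)) M₀) (α β : ℂ) (i : ℕ) (a₁ a₂ : M₀)
    (h : (-(i : ℂ) + α + a₁) * (-(i : ℂ) + α + a₂) ≠ 0) :
    Module.rank ℂ (wt M₀ α β (-(i : ℂ) + α + a₁))
      = Module.rank ℂ (wt M₀ α β (-(i : ℂ) + α + a₂)) := by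
  obtain ⟨x, hx0⟩ := AddSubgroup.ne_bot_iff_exists_ne_zero.mp hM₀
  have : Infinite M₀ := Infinite.of_injective (fun n : ℕ => n • x) fun n n' hn => by
    have := congrArg (Subtype.val) hn
    simpa [hx0] using this
  have htop := isTop_vbar M₀ α β
  obtain ⟨π, hπ, hneg, hfaith⟩ := exists_proj_vbar M₀ α β hdisj
  have hne : ∀ b, vbar M₀ α β b ≠ 0 := fun b hb => by
    have := hπ b
    rw [hb, map_zero] at this
    exact one_ne_zero (Finsupp.single_eq_zero.mp (this.symm : (Finsupp.single b (1 : ℂ)) = 0))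
  have hex : ∀ (s : M₀) (w : wt M₀ α β (-(i : ℂ) + α + s)),
      ∃ q : MvPolynomial (Fin i) ℂ, q.totalDegree ≤ 2 * i ∧ Describes (vbar M₀ α β) s w.1 q :=
    fun s w => exists_describes htop hdisj (mem_wt_iff.mp w.2)
  choose f hdeg hf using hex
  let Φ : ∀ s : M₀, wt M₀ α β (-(i : ℂ) + α + s) →ₗ[ℂ] MvPolynomial (Fin i) ℂ := fun s =>
    { toFun := f s
      -- Linearity follows from uniqueness of the describing polynomial.
      map_add' := fun x y => (hf s (x + y)).unique hne fun c => by
        rw [Submodule.coe_add, map_add, hf s x c, hf s y c, map_add, add_smul]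
      map_smul' := fun a x => (hf s (a • x)).unique hne fun c => by
        rw [Submodule.coe_smul, map_smul, hf s x c, RingHom.id_apply, MvPolynomial.smul_eval,
          mul_smul] }
  have hΦ : ∀ s, Function.Injective (Φ s) := by
    intro s
    rw [← LinearMap.ker_eq_bot, LinearMap.ker_eq_bot']
    intro w hw
    -- The zero polynomial means that all products of `i` operators from `L₁` kill `w`.
    refine Subtype.ext (htop.eq_zero_of_mem_sing hM₀ hdisj hneg hfaith (mem_wt_iff.mp w.2)
      (mem_sing_of_word fun c hc => ?_))
    subst hc
    have := hf s w c.get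
    rw [show f s w = 0 from hw, map_zero, zero_smul] at this
    convert this using 3
    refine List.ext_getElem (by simp [oneWord]) fun n h1 h2 => by simp [oneWord]
  have hrank : ∀ s : M₀, Module.rank ℂ (wt M₀ α β (-(i : ℂ) + α + s))
      = Module.rank ℂ (LinearMap.range (Φ s)) := fun s =>
    (LinearEquiv.ofInjective (Φ s) (hΦ s)).rank_eq
  rw [hrank, hrank]
  -- `low` bounds degrees strictly, hence `2 * i + 1`; with `i` variables the excluded value is
  -- exactly weight zero.
  refine rank_eq_of_polyOp α β (fun s => LinearMap.range (Φ s)) ?_ (2 * i + 1) ?_ ?_ ?_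
  · rintro x s _ ⟨w, rfl⟩
    have hmem : opr _ ((0, x) : Idx M₀) w.1 ∈ wt M₀ α β (-(i : ℂ) + α + (x + s : M₀)) := by
      rw [mem_wt_iff, opr_weight _ (mem_wt_iff.mp w.2), Prod.mk_add_mk, zero_add]
    exact ⟨⟨_, hmem⟩, (hf _ ⟨_, hmem⟩).unique hne ((hf s w).opr htop x)⟩
  · rintro s _ ⟨w, rfl⟩
    exact mem_low_of_totalDegree_lt (Nat.lt_succ_of_le (hdeg s w))
  · rw [Fintype.card_fin]
    convert left_ne_zero_of_mul h using 1
    ring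
  · rw [Fintype.card_fin]
    convert right_ne_zero_of_mul h using 1
    ring

end GenVir

end

theorem corollary3p2 (M₀ : AddSubgroup ℂ) (hM₀ : M₀ ≠ ⊥)
    (hdisj : Disjoint (AddSubgroup.zmultiples (1 : ℂ)) M₀) (α β : ℂ) (i : ℕ) (a₁ a₂ : M₀)
    (h : (-(i : ℂ) + α + a₁) * (-(i : ℂ) + α + a₂) ≠ 0) :
    Module.rank ℂ (GenVir.wt M₀ α β (-(i : ℂ) + α + a₁))
      = Module.rank ℂ (GenVir.wt M₀ α β (-(i : ℂ) + α + a₂)) :=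
  GenVir.rank_wt_eq M₀ hM₀ hdisj α β i a₁ a₂ h
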